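/- Let $\mathbb L$ be a field of characteristic zero, $\mathbb K\supseteq\mathbb L$ an algebraically closed field, $F\in\mathbb L[x,y,z]$ a squarefree polynomial, and $\mathcal S=\{p\in\mathbb K^3 : F(p)=0\}$. A rational parametrization of a set $Z\subseteq\mathbb K^3$ is a triple $P$ of rational functions over $\mathbb L$ (in $\mathbb L(s,t)$ for surfaces, in $\mathbb L(t)$ for curves) such that $Z$ is the Zariski closure of the image of $P$; it is proper if it is birational onto its image, i.e. if its components generate the field $\mathbb L(s,t)$, respectively $\mathbb L(t)$, over $\mathbb L$. $\mathcal S$ is called developable if it is ruled (swept out by straight lines: the union of the lines contained in $\mathcal S$ is Zariski dense in $\mathcal S$) and has zero Gaussian curvature (at every regular point, i.e. where $\nabla F\ne0$, the second fundamental form, which is up to a nonzero factor the Hessian form of $F$ restricted to the tangent plane, is degenerate). $\mathcal S$ is a rational developable surface if it is developable and has a rational parametrization $P(s,t)\in\mathbb L(s,t)^3$, not necessarily proper. $\mathcal S$ is conical with apex $P_0$ if it contains the line through $P_0$ and $p$ for all $p\in\mathcal S\setminus\{P_0\}$ (and contains $P_0$ if it is nonempty); cylindrical with ruling direction $P_1\neq0$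 if it contains the line through $p$ with direction $P_1$ for all $p\in\mathcal S$; tangential if it is the Zariski closure of the union of the tangent lines, at regular points, of an irreducible algebraic curve in $\mathbb K^3$ that is not contained in a plane. **Theorem.** $\mathcal S$ is a rational developable surface if and only if both of the following hold. 1. $K(x,y,z)=0$ for all points $(x,y,z)$ of $\mathcal S$, where $$K=\begin{vmatrix}F_{xx}&F_{xy}&F_{xz}&F_x\\F_{yx}&F_{yy}&F_{yz}&F_y\\F_{zx}&F_{zy}&F_{zz}&F_z\\F_x&F_y&F_z&0\end{vmatrix}.$$ 2. At least one of the following holds: - (i) $\mathcal S$ is a conical surface with some apex $P_0\in\mathbb L^3$, and there is a plane $\mathcal H$ with coefficients in $\mathbb L$, not passing through $P_0$, such that the planar section $\mathcal C=\mathcal S\cap\mathcal H$ has a proper rational parametrization $Q(t)\in\mathbb L(t)^3$ and $(1-s)P_0+sQ(t)$ is a proper rational parametrization of $\mathcal S$; - (ii) $\mathcal S$ is a cylindrical surface with some ruling direction $0\ne P_1\in\mathbb L^3$, and there is a plane $\mathcal H$ with coefficients in $\mathbb L$, not parallel to $P_1$, such that the planar section $\mathcal C=\mathcal S\cap\mathcal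 H$ has a proper rational parametrization $Q(t)\in\mathbb L(t)^3$ and $Q(t)+sP_1$ is a proper rational parametrization of $\mathcal S$; - (iii) $\mathcal S$ is a tangential surface, and there is a curve $\mathcal C\subseteq\mathcal S$, not contained in a plane and consisting of singular points of $\mathcal S$ (points with $F=F_x=F_y=F_z=0$), that has a proper rational parametrization $P_0(t)\in\mathbb L(t)^3$ such that $P_0(t)+sP_0'(t)$ is a proper rational parametrization of $\mathcal S$. -/

import Mathlib

noncomputable section

namespace DevelopableSurface

open MvPolynomial

/-! Throughout, `L` is the field of coefficients and `K` an algebraically closed extension field;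
varieties are sets of points of the affine space `K³`. -/

section Surfaces

variable {L : Type*} [Field L] (K : Type*) [Field K] [Algebra L K]

/-- The point of `K³` given by a point of `L³`. -/
def basePoint (p : Fin 3 → L) : Fin 3 → K := fun i => algebraMap L K (p i)

/-- The algebraic surface `F = 0` in `K³`. -/
def surface (F : MvPolynomial (Fin 3) L) : Set (Fin 3 → K) := {p | aeval p F = 0}

variable {K}

/-- The gradient `(F_x, F_y, F_z)` at the point `p`. -/
def polyGradient (F : MvPolynomial (Fin 3) L) (p : Fin 3 → K) : Fin 3 → K :=
  fun i => aeval p (pderiv i F)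

/-- The Hessian quadratic form of `F` at `p`, as a bilinear expression in `v` and `w`. -/
def hessian (F : MvPolynomial (Fin 3) L) (p v w : Fin 3 → K) : K :=
  ∑ i, ∑ j, aeval p (pderiv i (pderiv j F)) * v i * w j

/-- The bordered Hessian determinant `K(x, y, z)` of `F`. -/
def borderedHessian (F : MvPolynomial (Fin 3) L) : MvPolynomial (Fin 3) L :=
  Matrix.det
    !![pderiv 0 (pderiv 0 F), pderiv 1 (pderiv 0 F), pderiv 2 (pderiv 0 F), pderiv 0 F;
       pderiv 0 (pderiv 1 F), pderiv 1 (pderiv 1 F), pderiv 2 (pderiv 1 F), pderiv 1 F;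
       pderiv 0 (pderiv 2 F), pderiv 1 (pderiv 2 F), pderiv 2 (pderiv 2 F), pderiv 2 F;
       pderiv 0 F, pderiv 1 F, pderiv 2 F, 0]

variable (K) in
/-- Zero Gaussian curvature: at each regular point of `F = 0` the second fundamental form is
degenerate on the tangent plane.  Up to a nonzero scalar, the second fundamental form is the
restriction of the Hessian form of `F` to the tangent plane `∇F · v = 0`, and the numerator of the
Gaussian curvature is its determinant `II(v,v) II(w,w) - II(v,w)²` on tangent vectors `v`, `w`. -/
def HasZeroGaussianCurvature (F : MvPolynomial (Fin 3) L) : Prop :=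
  ∀ p ∈ surface K F, polyGradient F p ≠ 0 →
    ∀ v w : Fin 3 → K, polyGradient F p ⬝ᵥ v = 0 → polyGradient F p ⬝ᵥ w = 0 →
      hessian F p v v * hessian F p w w - hessian F p v w ^ 2 = 0

end Surfaces

section Geometry

variable {K : Type*} [Field K]

/-- The line through `p` with direction `v`. -/
def line (p v : Fin 3 → K) : Set (Fin 3 → K) := {q | ∃ c : K, q = p + c • v}

/-- The plane `a · q = b`. -/
def plane (a : Fin 3 → K) (b : K) : Set (Fin 3 → K) := {q | a ⬝ᵥ q = b}

/-- The Zariski closure of a set of points in `K³`. -/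
def zariskiClosure (T : Set (Fin 3 → K)) : Set (Fin 3 → K) :=
  zeroLocus K (vanishingIdeal K T)

/-- `S` is ruled: it is swept out by the straight lines it contains, that is, the union of these
lines is Zariski dense in `S`. -/
def IsRuled (S : Set (Fin 3 → K)) : Prop :=
  S = zariskiClosure {q | ∃ p v : Fin 3 → K, v ≠ 0 ∧ line p v ⊆ S ∧ q ∈ line p v}

/-- `S` is a conical surface with apex `P₀`: it is a union of lines through `P₀`. -/
def IsConical (S : Set (Fin 3 → K)) (P₀ : Fin 3 → K) : Prop :=
  ∀ p ∈ S, line P₀ (p - P₀) ⊆ S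

/-- `S` is a cylindrical surface with ruling direction `P₁`: it is a union of lines parallel
to the nonzero vector `P₁`. -/
def IsCylindrical (S : Set (Fin 3 → K)) (P₁ : Fin 3 → K) : Prop :=
  P₁ ≠ 0 ∧ ∀ p ∈ S, line p P₁ ⊆ S

/-- `C` is an irreducible algebraic curve in `K³`: a Zariski closed irreducible set whose
coordinate ring has transcendence degree one. -/
def IsAlgebraicCurve (C : Set (Fin 3 → K)) : Prop :=
  C = zariskiClosure C ∧ (vanishingIdeal K C).IsPrime ∧
    Algebra.trdeg K (MvPolynomial (Fin 3) K ⧸ vanishingIdeal K C) = 1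

/-- `C` is contained in a plane. -/
def IsPlanar (C : Set (Fin 3 → K)) : Prop :=
  ∃ (a : Fin 3 → K) (b : K), a ≠ 0 ∧ C ⊆ plane a b

/-- The Zariski tangent space of `C` at `p`, as a space of direction vectors. -/
def tangentSpace (C : Set (Fin 3 → K)) (p : Fin 3 → K) : Submodule K (Fin 3 → K) where
  carrier := {v | ∀ G ∈ vanishingIdeal K C, polyGradient G p ⬝ᵥ v = 0}
  zero_mem' := fun G _ => dotProduct_zero _
  add_mem' := fun hv hw G hG => by rw [dotProduct_add, hv G hG, hw G hG, add_zero]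
  smul_mem' := fun c v hv G hG => by rw [dotProduct_smul, hv G hG, smul_zero]

/-- The union of the tangent lines of the curve `C` at its regular points. -/
def tangentLines (C : Set (Fin 3 → K)) : Set (Fin 3 → K) :=
  {q | ∃ p ∈ C, Module.finrank K (tangentSpace C p) = 1 ∧ q - p ∈ tangentSpace C p}

/-- `S` is a tangential surface: it is the surface swept out by the tangent lines of a space curve
(an irreducible algebraic curve not contained in a plane). -/
def IsTangential (S : Set (Fin 3 → K)) : Prop :=
  ∃ C : Set (Fin 3 → K), IsAlgebraicCurve C ∧ ¬ IsPlanar C ∧ S = zariskiClosure (tangentLines C)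

end Geometry

section Parametrizations

variable {L : Type*} [Field L] {K : Type*} [Field K] [Algebra L K]

/-- Let `E` be a field of rational functions over `L`.  The triple `P ∈ E³` is a rational
parametrization of `Z ⊆ K³`: `Z` is the Zariski closure of the image of `P`, that is, the set
of common zeros of all polynomials `G` with `G(P) = 0` in `E`. -/
def IsParametrization {E : Type*} [Field E] [Algebra L E] (P : Fin 3 → E)
    (Z : Set (Fin 3 → K)) : Prop :=
  Z = zeroLocus K (RingHom.ker (aeval P : MvPolynomial (Fin 3) L →ₐ[L] E))

variable (L) in
/-- A rational parametrization is proper if it is birational onto its image, that is, if its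
components generate the whole field `E` of rational functions over `L`. -/
def IsProperParametrization {E : Type*} [Field E] [Algebra L E] (P : Fin 3 → E)
    (Z : Set (Fin 3 → K)) : Prop :=
  IsParametrization (L := L) P Z ∧ IntermediateField.adjoin L (Set.range P) = ⊤

variable (L) in
/-- The field `L(s, t)`, as the field of rational functions in `s` over `L(t)`. -/
abbrev RatFunc₂ : Type _ := RatFunc (RatFunc L)

/-- The variable `s` of `L(s, t)`. -/
def sVar : RatFunc₂ L := RatFunc.X

/-- The inclusion of `L(t)` in `L(s, t)`. -/
def inT (f : RatFunc L) : RatFunc₂ L := RatFunc.C f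

/-- The derivative of a rational function in one variable. -/
def ratDeriv (f : RatFunc L) : RatFunc L :=
  algebraMap (Polynomial L) (RatFunc L)
      (Polynomial.derivative f.num * f.denom - f.num * Polynomial.derivative f.denom) /
    algebraMap (Polynomial L) (RatFunc L) (f.denom ^ 2)

/-- The cone over a curve: `(1 - s) P₀ + s Q(t)`. -/
def coneParam (P₀ : Fin 3 → L) (Q : Fin 3 → RatFunc L) : Fin 3 → RatFunc₂ L :=
  fun i => (1 - sVar) * inT (RatFunc.C (P₀ i)) + sVar * inT (Q i)

/-- The cylinder over a curve: `Q(t) + s P₁`. -/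
def cylinderParam (P₁ : Fin 3 → L) (Q : Fin 3 → RatFunc L) : Fin 3 → RatFunc₂ L :=
  fun i => inT (Q i) + sVar * inT (RatFunc.C (P₁ i))

/-- The tangent surface of a curve: `Q(t) + s Q'(t)`. -/
def tangentParam (Q : Fin 3 → RatFunc L) : Fin 3 → RatFunc₂ L :=
  fun i => inT (Q i) + sVar * inT (ratDeriv (Q i))

end Parametrizations

section Developable

variable {L : Type*} [Field L] (K : Type*) [Field K] [Algebra L K]

/-- `F = 0` is a developable surface: a ruled surface with zero Gaussian curvature. -/
def IsDevelopable (F : MvPolynomial (Fin 3) L) : Prop :=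
  IsRuled (surface K F) ∧ HasZeroGaussianCurvature K F

/-- `F = 0` is a rational developable surface: a developable surface that has a rational (not
necessarily proper) parametrization `P(s, t) ∈ L(s, t)³`. -/
def IsRationalDevelopable (F : MvPolynomial (Fin 3) L) : Prop :=
  IsDevelopable K F ∧
    ∃ P : Fin 3 → RatFunc₂ L, IsParametrization (L := L) P (surface K F)

/-- The conical case, with apex `P₀` and a rational section by a plane not through `P₀`. -/
def ConicalCase (F : MvPolynomial (Fin 3) L) : Prop :=
  ∃ P₀ : Fin 3 → L, IsConical (surface K F) (basePoint K P₀) ∧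
    ∃ (a : Fin 3 → L) (b : L) (Q : Fin 3 → RatFunc L),
      a ≠ 0 ∧ basePoint K P₀ ∉ plane (basePoint K a) (algebraMap L K b) ∧
      IsProperParametrization L Q
        (surface K F ∩ plane (basePoint K a) (algebraMap L K b)) ∧
      IsProperParametrization L (coneParam P₀ Q) (surface K F)

/-- The cylindrical case, with ruling direction `P₁` and a rational section by a plane not
parallel to `P₁`. -/
def CylindricalCase (F : MvPolynomial (Fin 3) L) : Prop :=
  ∃ P₁ : Fin 3 → L, IsCylindrical (surface K F) (basePoint K P₁) ∧
    ∃ (a : Fin 3 → L) (b : L) (Q : Fin 3 → RatFunc L),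
      a ⬝ᵥ P₁ ≠ 0 ∧
      IsProperParametrization L Q
        (surface K F ∩ plane (basePoint K a) (algebraMap L K b)) ∧
      IsProperParametrization L (cylinderParam P₁ Q) (surface K F)

/-- The tangential case, with a rational singular space curve `C`. -/
def TangentialCase (F : MvPolynomial (Fin 3) L) : Prop :=
  IsTangential (surface K F) ∧
    ∃ (C : Set (Fin 3 → K)) (Q : Fin 3 → RatFunc L),
      C ⊆ surface K F ∧ (∀ p ∈ C, polyGradient F p = 0) ∧ ¬ IsPlanar C ∧
      IsProperParametrization L Q C ∧
      IsProperParametrization L (tangentParam Q) (surface K F)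

end Developable

end DevelopableSurface

end

open DevelopableSurface

/-!
Zero Gaussian curvature is the vanishing of the bordered Hessian, because both are values of the
adjugate of the Hessian form, at `v × w` and at `∇F` (`hasZeroGaussianCurvature_iff`).  In each of
the three cases a parametrization is given and the surface is visibly swept out by lines.  The
content is that a parametrized surface of curvature zero belongs to one of the cases.

Let `P(s, t)` be a parametrization.  The polynomials that vanish at the generic point `P` are the
multiples of `F`, so differential geometry can be done algebraically, with the derivations `∂/∂s`
and `∂/∂t` of `L(s, t)`.  Curvature zero gives a derivation `D ≠ 0` that changes `∇F(P)` only by a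
factor; hence `D` kills the tangent plane `ν · x = c` at `P`, normalized by `ν_j = 1`
(`exists_tangent_plane`).  If the tangent plane is not constant, its coefficients generate a field
of transcendence degree one, which is the image of an embedding `φ` of `L(t)` by Lüroth's theorem;
the field is first carried into `L(t)` by a substitution `s = f(t)` (`exists_algHom_fieldRange_eq`,
`exists_dual_curve`).  So the surface is the envelope of a family `N(t) · x = c(t)`, and `P` lies on
the line in which this plane meets its derivative `N' · x = c'`.  Write the line as `A + τ B`.  The
vectors `A'` and `B'` are proportional.  If `B' = 0` the surface is a cylinder; otherwise
`A' = β B'`, and the point `R = A - β B` satisfies `R' = -β' B`.  It is the apex of a cone if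
`β' = 0`, and otherwise it runs through a curve whose tangents are the lines (`exists_form`).

The normalized parameters are rational functions of the point, so the resulting parametrization
`X(t) + s Y(t)` is proper (`ruledParam_proper`).  That the base curve is properly parametrized too
rests on Lüroth's theorem in `L(t)`: a subfield is stable under differentiation up to a common
factor, so the tangent plane can be recovered from the curve (`exists_dX_div_mem`,
`eq_top_of_plane`).  The closed conditions on all points of the surface (being a cone or a cylinder,
the equations of the plane sections) follow from polynomial identities at the generic point
(`aeval_eval_eq_zero`).

For a tangent surface the curve is studied through its points `X(a)` with `a ∈ L`.  Linear forms
`K → L` applied to coefficients show that a polynomial over `K` vanishing at infinitely many of them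
is a combination of equations over `L` of the curve (`mem_map_ker_of_frequently`).  This gives
irreducibility, the transcendence degree, the tangent spaces at almost all points, and that the
tangent lines are dense in the surface; conversely, a tangent vector field given by the cross
product of two gradients shows that every tangent line lies on the surface (`tangentLines_subset`).
-/

noncomputable section
namespace DevelopableSurface
open MvPolynomial

/-! ### Derivations of rational function fields -/

section Derivations

/-- A derivation of a domain extends to its field of fractions. -/
theorem exists_derivation_extension {R A E : Type*} [CommRing R] [CommRing A] [IsDomain A]
    [Field E] [Algebra R A] [Algebra A E] [Algebra R E] [IsScalarTower R A E]
    [IsFractionRing A E] (d : Derivation R A A) :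
    ∃ D : Derivation R E E, ∀ a, D (algebraMap A E a) = algebraMap A E (d a) := by
  have : Algebra.FormallyEtale A E := Algebra.FormallyEtale.of_isLocalization (nonZeroDivisors A)
  let g : Derivation R A E := (Algebra.linearMap A E).compDer d
  refine ⟨((LinearMap.liftBaseChange E g.liftKaehlerDifferential).comp
    (KaehlerDifferential.tensorKaehlerEquivOfFormallyEtale R A E).symm.toLinearMap).compDer
    (KaehlerDifferential.D R E), fun a => ?_⟩
  have h := KaehlerDifferential.tensorKaehlerEquivOfFormallyEtale_symm_D_algebraMap R A E a
  change LinearMap.liftBaseChange E g.liftKaehlerDifferential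
    ((KaehlerDifferential.tensorKaehlerEquivOfFormallyEtale R A E).symm
      (KaehlerDifferential.D R E (algebraMap A E a))) = _
  rw [h]
  simp [g]

/-- The coefficientwise action of a derivation on polynomials. -/
def coeffDeriv {R k : Type*} [CommRing R] [Field k] [Algebra R k] (d : Derivation R k k) :
    Derivation R (Polynomial k) (Polynomial k) :=
  PolynomialModule.equivPolynomialSelf.toLinearMap.compDer d.mapCoeffs

theorem coeff_coeffDeriv {R k : Type*} [CommRing R] [Field k] [Algebra R k] (d : Derivation R k k)
    (p : Polynomial k) (i : ℕ) : (coeffDeriv d p).coeff i = d (p.coeff i) := rfl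

/-- A derivation kills every element that is algebraic over a field of constants. -/
theorem derivation_eq_zero_of_isAlgebraic {L E : Type*} [Field L] [CharZero L] [Field E]
    [Algebra L E] (D : Derivation L E E) (M : IntermediateField L E) (hM : ∀ m ∈ M, D m = 0)
    {a : E} (ha : IsAlgebraic M a) : D a = 0 := by
  have hz : CharZero M := charZero_of_injective_algebraMap (algebraMap L M).injective
  let D' : Derivation M E E := Derivation.mk'
    { toFun := D
      map_add' := fun x y => D.map_add x y
      map_smul' := fun m x => by
        simp [Algebra.smul_def, D.leibniz, hM m m.2] } (fun x y => D.leibniz x y)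
  have h := D'.map_aeval (minpoly M a) a
  rw [minpoly.aeval, map_zero] at h
  have hs := (minpoly.irreducible ha.isIntegral).separable.aeval_derivative_ne_zero
    (minpoly.aeval M a)
  exact (smul_eq_zero.mp h.symm).resolve_left hs

/-- The field of constants of a derivation. -/
def constants {L E : Type*} [Field L] [Field E] [Algebra L E] (D : Derivation L E E) :
    IntermediateField L E where
  carrier := {x | D x = 0}
  mul_mem' := fun {a b} (ha : D a = 0) (hb : D b = 0) => by
    simp [D.leibniz, ha, hb]
  add_mem' := fun {a b} (ha : D a = 0) (hb : D b = 0) => by simp [ha, hb]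
  algebraMap_mem' := fun r => by simp
  inv_mem' := fun a (ha : D a = 0) => by
    simp [D.leibniz_inv, ha]

end Derivations

section RatFuncDerivation

variable (k : Type*) [Field k]

/-- The derivation `d/dX` of the field of rational functions `k(X)`. -/
def dX : Derivation k (RatFunc k) (RatFunc k) :=
  (exists_derivation_extension (E := RatFunc k) (Polynomial.derivative' (R := k))).choose

variable {k}

theorem dX_algebraMap (p : Polynomial k) :
    dX k (algebraMap _ _ p) = algebraMap _ _ (Polynomial.derivative p) :=
  (exists_derivation_extension (E := RatFunc k) (Polynomial.derivative' (R := k))).choose_spec p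

@[simp] theorem dX_X : dX k RatFunc.X = 1 := by
  rw [← RatFunc.algebraMap_X, dX_algebraMap]; simp

@[simp] theorem dX_C (c : k) : dX k (RatFunc.C c) = 0 := by
  rw [← RatFunc.algebraMap_eq_C]; exact (dX k).map_algebraMap c

theorem ratDeriv_eq_dX (f : RatFunc k) : ratDeriv f = dX k f := by
  conv_rhs => rw [← RatFunc.num_div_denom f]
  have h : algebraMap (Polynomial k) (RatFunc k) f.denom ≠ 0 :=
    RatFunc.algebraMap_ne_zero f.denom_ne_zero
  rw [Derivation.leibniz_div, dX_algebraMap, dX_algebraMap, ratDeriv]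
  simp only [smul_eq_mul, map_sub, map_mul, map_pow]
  field_simp

/-- If a derivation lowers the degree of monic polynomials, then it kills the numerator and the
denominator of every fraction that it kills: the monic denominator divides its own derivative. -/
theorem num_denom_of_derivation_eq_zero {R : Type*} [CommRing R] [Algebra R k]
    (D : Derivation R (RatFunc k) (RatFunc k)) (d : Polynomial k → Polynomial k)
    (hD : ∀ p, D (algebraMap _ _ p) = algebraMap _ _ (d p))
    (hd : ∀ p : Polynomial k, p.Monic → d p = 0 ∨ (d p).degree < p.degree)
    {f : RatFunc k} (hf : D f = 0) : d f.num = 0 ∧ d f.denom = 0 := by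
  have h : algebraMap (Polynomial k) (RatFunc k) f.denom ≠ 0 :=
    RatFunc.algebraMap_ne_zero f.denom_ne_zero
  rw [← RatFunc.num_div_denom f, Derivation.leibniz_div, hD, hD, smul_eq_mul] at hf
  have h1 : f.denom * d f.num - f.num * d f.denom = 0 := by
    have := (mul_eq_zero.mp hf).resolve_left (by simp [RatFunc.denom_ne_zero])
    apply RatFunc.algebraMap_injective k
    simpa only [smul_eq_mul, map_sub, map_mul, map_zero] using this
  have h2 : f.denom ∣ d f.denom := by
    apply (RatFunc.isCoprime_num_denom f).symm.dvd_of_dvd_mul_left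
    exact ⟨d f.num, by linear_combination -h1⟩
  have h3 : d f.denom = 0 := by
    rcases hd _ f.monic_denom with h0 | h0
    · exact h0
    · by_contra hne
      exact absurd (Polynomial.degree_le_of_dvd h2 hne) (not_le.mpr h0)
  refine ⟨?_, h3⟩
  rw [h3, mul_zero, sub_zero] at h1
  exact (mul_eq_zero.mp h1).resolve_left f.denom_ne_zero

theorem eq_C_of_dX_eq_zero [CharZero k] {f : RatFunc k} (hf : dX k f = 0) :
    ∃ c, f = RatFunc.C c := by
  have h := num_denom_of_derivation_eq_zero (dX k) _ dX_algebraMap (fun p _ => ?_) hf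
  · rw [RatFunc.eq_C_iff]
    exact ⟨Polynomial.derivative_eq_zero.mp h.1,
      Polynomial.derivative_eq_zero.mp h.2⟩
  · by_cases h0 : p = 0
    · left; simp [h0]
    · exact Or.inr (Polynomial.degree_derivative_lt h0)

/-- The chain rule for the substitution of an element of `E` in a rational function. -/
theorem derivation_algHom {E : Type*} [Field E] [Algebra k E] (δ : Derivation k E E)
    (φ : RatFunc k →ₐ[k] E) (f : RatFunc k) : δ (φ f) = δ (φ RatFunc.X) * φ (dX k f) := by
  have hp : ∀ p : Polynomial k, δ (φ (algebraMap _ _ p)) =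
      δ (φ RatFunc.X) * φ (algebraMap _ _ (Polynomial.derivative p)) := by
    intro p
    have h : ∀ p : Polynomial k, φ (algebraMap _ _ p) = Polynomial.aeval (φ RatFunc.X) p := by
      intro p
      rw [← RatFunc.aeval_X_left_eq_algebraMap, Polynomial.aeval_algHom_apply]
    rw [h, h, Derivation.map_aeval, smul_eq_mul, mul_comm]
  have h0 : φ (algebraMap _ _ f.denom) ≠ 0 := by
    simp [RatFunc.denom_ne_zero]
  conv_lhs => rw [← RatFunc.num_div_denom f]
  conv_rhs => rw [← RatFunc.num_div_denom f]
  rw [map_div₀, Derivation.leibniz_div, Derivation.leibniz_div, dX_algebraMap, dX_algebraMap,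
    hp, hp]
  simp only [smul_eq_mul, map_mul, map_sub, map_pow, map_inv₀]
  ring

end RatFuncDerivation

section TwoVariables

variable (L : Type*) [Field L]

/-- The derivation `∂/∂s` of `L(s, t)`. -/
def dS : Derivation L (RatFunc₂ L) (RatFunc₂ L) := (dX (RatFunc L)).restrictScalars L

/-- The derivation `∂/∂t` of `L(s, t)`. -/
def dT : Derivation L (RatFunc₂ L) (RatFunc₂ L) :=
  (exists_derivation_extension (E := RatFunc₂ L) (coeffDeriv (dX L))).choose

variable {L}

theorem dT_algebraMap (p : Polynomial (RatFunc L)) :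
    dT L (algebraMap _ _ p) = algebraMap _ _ (coeffDeriv (dX L) p) :=
  (exists_derivation_extension (E := RatFunc₂ L) (coeffDeriv (dX L))).choose_spec p

@[simp] theorem dS_sVar : dS L sVar = 1 := dX_X

@[simp] theorem dS_inT (f : RatFunc L) : dS L (inT f) = 0 := dX_C f

@[simp] theorem dT_sVar : dT L sVar = 0 := by
  rw [sVar, ← RatFunc.algebraMap_X, dT_algebraMap]
  simp only [map_eq_zero_iff _ (RatFunc.algebraMap_injective (RatFunc L))]
  ext i
  rw [coeff_coeffDeriv, Polynomial.coeff_X]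
  split <;> simp

@[simp] theorem dT_inT (f : RatFunc L) : dT L (inT f) = inT (dX L f) := by
  rw [inT, inT, ← RatFunc.algebraMap_C, dT_algebraMap, ← RatFunc.algebraMap_C]
  congr 1
  ext i
  rw [coeff_coeffDeriv, Polynomial.coeff_C, Polynomial.coeff_C]
  split <;> simp

theorem degree_coeffDeriv_lt (p : Polynomial (RatFunc L)) (hp : p.Monic) :
    coeffDeriv (dX L) p = 0 ∨ (coeffDeriv (dX L) p).degree < p.degree := by
  right
  rw [Polynomial.degree_eq_natDegree hp.ne_zero, Polynomial.degree_lt_iff_coeff_zero]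
  intro m hm
  rw [coeff_coeffDeriv]
  rcases hm.eq_or_lt with h | h
  · rw [← h, hp.coeff_natDegree]; simp
  · rw [Polynomial.coeff_eq_zero_of_natDegree_lt h]; simp

/-- The elements of `L(s, t)` killed by `∂/∂t` are the rational functions of `s`: numerator and
denominator have coefficients in `L`. -/
theorem lifts_of_dT_eq_zero [CharZero L] {x : RatFunc₂ L} (hx : dT L x = 0) :
    (∃ p : Polynomial L, x.num = p.map RatFunc.C) ∧
      ∃ q : Polynomial L, x.denom = q.map RatFunc.C := by
  have h := num_denom_of_derivation_eq_zero (dT L) _ dT_algebraMap degree_coeffDeriv_lt hx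
  have key : ∀ p : Polynomial (RatFunc L), coeffDeriv (dX L) p = 0 →
      ∃ q : Polynomial L, p = q.map RatFunc.C := by
    intro p hp
    have : p ∈ Polynomial.lifts (RatFunc.C (K := L)) := by
      rw [Polynomial.lifts_iff_coeff_lifts]
      intro n
      obtain ⟨c, hc⟩ := eq_C_of_dX_eq_zero (f := p.coeff n) (by
        rw [← coeff_coeffDeriv, hp, Polynomial.coeff_zero])
      exact ⟨c, hc.symm⟩
    obtain ⟨q, hq⟩ := (Polynomial.mem_lifts p).mp this
    exact ⟨q, hq.symm⟩
  exact ⟨key _ h.1, key _ h.2⟩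

/-- The only common constants of `∂/∂s` and `∂/∂t` are the elements of `L`. -/
theorem exists_algebraMap_eq [CharZero L] {x : RatFunc₂ L} (hs : dS L x = 0) (ht : dT L x = 0) :
    ∃ c : L, x = algebraMap L (RatFunc₂ L) c := by
  obtain ⟨f, rfl⟩ := eq_C_of_dX_eq_zero (k := RatFunc L) hs
  have h : inT (dX L f) = 0 := by rw [← dT_inT]; exact ht
  obtain ⟨c, rfl⟩ := eq_C_of_dX_eq_zero (f := f)
    ((map_eq_zero_iff _ (RatFunc.C_injective (K := RatFunc L))).mp h)
  refine ⟨c, ?_⟩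
  rw [IsScalarTower.algebraMap_apply L (RatFunc L) (RatFunc₂ L), RatFunc.algebraMap_eq_C,
    RatFunc.algebraMap_eq_C]

open Algebra in
theorem trdeg_ratFunc (k : Type*) [Field k] : trdeg k (RatFunc k) = 1 := by
  have : Algebra.IsAlgebraic (Polynomial k) (RatFunc k) :=
    IsLocalization.isAlgebraic _ (nonZeroDivisors _)
  rw [← trdeg_add_eq k (Polynomial k) (A := RatFunc k),
    Polynomial.trdeg_of_isDomain, trdeg_eq_zero (R := Polynomial k), add_zero]

open Algebra in
theorem trdeg_ratFunc₂ : trdeg L (RatFunc₂ L) = 2 := by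
  rw [← trdeg_add_eq L (RatFunc L) (A := RatFunc₂ L), trdeg_ratFunc, trdeg_ratFunc,
    one_add_one_eq_two]

/-- A derivation of `L(s, t)` that kills two algebraically independent elements is zero. -/
theorem derivation_eq_zero_of_algebraicIndependent [CharZero L]
    (D : Derivation L (RatFunc₂ L) (RatFunc₂ L)) {x : Fin 2 → RatFunc₂ L}
    (hx : AlgebraicIndependent L x) (hD : ∀ i, D (x i) = 0) (y : RatFunc₂ L) : D y = 0 := by
  have hb : IsTranscendenceBasis L x := by
    apply hx.isTranscendenceBasis_of_lift_trdeg_le_of_finite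
    simp [trdeg_ratFunc₂]
  have := hb.isAlgebraic_field
  exact derivation_eq_zero_of_isAlgebraic D (IntermediateField.adjoin L (Set.range x))
    (fun m hm => by
      have : IntermediateField.adjoin L (Set.range x) ≤ constants D := by
        rw [IntermediateField.adjoin_le_iff]
        rintro _ ⟨i, rfl⟩
        exact hD i
      exact this hm) (this.isAlgebraic y)

end TwoVariables

end DevelopableSurface
end

noncomputable section
namespace DevelopableSurface
open MvPolynomial

/-! ### Lüroth's theorem for fields of transcendence degree one in two variables -/

section Specialization

variable {L : Type*} [Field L]

section

variable {k : Type*} [Field k] (R : Type*) [CommRing R] [Algebra R k]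

/-- The rational functions over `k` that are defined at `a`: those whose denominator does not vanish
at `a`.  For `k = L(t)` these are the functions `x(s, t)` in which one may substitute `s = a(t)`. -/
def specializable (a : k) : Subalgebra R (RatFunc k) where
  carrier := {x | x.denom.eval₂ (RingHom.id _) a ≠ 0}
  mul_mem' := fun {x y} hx hy h => by
    have := Polynomial.eval₂_eq_zero_of_dvd_of_eval₂_eq_zero (RingHom.id _) a
      (RatFunc.denom_mul_dvd x y) h
    rw [Polynomial.eval₂_mul] at this
    exact (mul_ne_zero hx hy) this
  add_mem' := fun {x y} hx hy h => by
    have := Polynomial.eval₂_eq_zero_of_dvd_of_eval₂_eq_zero (RingHom.id _) a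
      (RatFunc.denom_add_dvd x y) h
    rw [Polynomial.eval₂_mul] at this
    exact (mul_ne_zero hx hy) this
  algebraMap_mem' := fun r => by
    rw [IsScalarTower.algebraMap_apply R k (RatFunc k), RatFunc.algebraMap_eq_C]
    simp

/-- The evaluation at `a` of the rational functions that are defined there. -/
def specialize (a : k) : specializable R a →ₐ[R] k where
  toFun x := RatFunc.eval (RingHom.id _) a x
  map_one' := by simp
  map_mul' x y := RatFunc.eval_mul _ _ x.2 y.2
  map_zero' := by simp
  map_add' x y := RatFunc.eval_add _ _ x.2 y.2
  commutes' r := by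
    change RatFunc.eval _ a (algebraMap R (RatFunc k) r) = _
    rw [IsScalarTower.algebraMap_apply R k (RatFunc k), RatFunc.algebraMap_eq_C]
    simp

theorem specialize_apply (a : k) (x : specializable R a) :
    specialize R a x = RatFunc.eval (RingHom.id _) a (x : RatFunc k) := rfl

end

theorem inv_mem_specializable {f : RatFunc L} {x : RatFunc₂ L}
    (h : x.num.eval₂ (RingHom.id _) f ≠ 0) : x⁻¹ ∈ specializable L f := by
  intro h0
  apply h
  refine Polynomial.eval₂_eq_zero_of_dvd_of_eval₂_eq_zero (RingHom.id _) f ?_ h0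
  have : x⁻¹ = algebraMap _ _ x.denom / algebraMap _ _ x.num := by
    conv_lhs => rw [← RatFunc.num_div_denom x]
    rw [inv_div]
  rw [this]
  exact RatFunc.denom_div_dvd _ _

/-- `specializable f` is a valuation ring. -/
theorem mem_or_inv_mem_specializable (f : RatFunc L) (x : RatFunc₂ L) :
    x ∈ specializable L f ∨ x⁻¹ ∈ specializable L f := by
  by_cases h : x.denom.eval₂ (RingHom.id _) f = 0
  · right
    apply inv_mem_specializable
    intro h0
    obtain ⟨a, b, hab⟩ := RatFunc.isCoprime_num_denom x
    have := congrArg (Polynomial.eval₂ (RingHom.id _) f) hab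
    simp [h, h0] at this
  · exact Or.inl h

theorem inv_mem_specializable_of_specialize_ne_zero {f : RatFunc L} (x : specializable L f)
    (h : specialize L f x ≠ 0) : (x : RatFunc₂ L)⁻¹ ∈ specializable L f := by
  apply inv_mem_specializable
  intro h0
  apply h
  rw [specialize_apply, RatFunc.eval, h0, zero_div]

/-- The simple case of `le_specializable`: the denominators `q(m)` do not vanish under the
substitution, since the value of `m` is transcendental over `L`. -/
theorem adjoin_le_specializable {f : RatFunc L} (m : specializable L f)
    (hm : ¬ ∃ c, specialize L f m = RatFunc.C c) {x : RatFunc₂ L}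
    (hx : x ∈ IntermediateField.adjoin L {(m : RatFunc₂ L)}) : x ∈ specializable L f := by
  obtain ⟨r, q, rfl⟩ := (IntermediateField.mem_adjoin_simple_iff _ _).mp hx
  have h : ∀ p : Polynomial L, Polynomial.aeval (m : RatFunc₂ L) p =
      (Polynomial.aeval m p : specializable L f) := fun p => by simp
  rw [div_eq_mul_inv]
  refine mul_mem (by rw [h]; exact Subtype.property _) ?_
  by_cases hq : q = 0
  · simp [hq]
  rw [h]
  apply inv_mem_specializable_of_specialize_ne_zero
  rw [← Polynomial.aeval_algHom_apply]
  exact transcendental_iff.mp (RatFunc.transcendental_of_ne_C _ hm) q |>.mt hq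

/-- If a subfield of `L(s, t)` is algebraic over `L(m)` and the substitution `s = f(t)` turns `m`
into a nonconstant function, then this substitution is defined on the whole subfield: it is defined
at `x` or at `x⁻¹`, and the subring where it is defined contains the field `L(m)`, hence also the
inverses of its elements that are algebraic over `L(m)`. -/
theorem le_specializable {f : RatFunc L} (m : specializable L f)
    (hm : ¬ ∃ c, specialize L f m = RatFunc.C c) (M : IntermediateField L (RatFunc₂ L))
    (halg : ∀ y ∈ M, IsAlgebraic (IntermediateField.adjoin L {(m : RatFunc₂ L)}) y)
    {x : RatFunc₂ L} (hx : x ∈ M) : x ∈ specializable L f := by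
  rcases mem_or_inv_mem_specializable f x with h | h
  · exact h
  · let F₀ := IntermediateField.adjoin L {(m : RatFunc₂ L)}
    let O : Subalgebra F₀ (RatFunc₂ L) :=
      { (specializable L f).toSubsemiring with
        algebraMap_mem' := fun r => adjoin_le_specializable m hm r.2 }
    have := O.inv_mem_of_algebraic (x := ⟨x⁻¹, h⟩) (halg _ (inv_mem hx))
    simp only [inv_inv] at this
    exact this

/-- Every element of `L(s, t)` outside `L` stays nonconstant under a suitable substitution
`s = f(t)`. -/
theorem exists_specialization [CharZero L] {m : RatFunc₂ L}
    (hm : ¬ ∃ c : L, m = algebraMap L (RatFunc₂ L) c) :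
    ∃ (f : RatFunc L) (h : m ∈ specializable L f), ¬ ∃ c, specialize L f ⟨m, h⟩ = RatFunc.C c := by
  by_cases hT : dT L m = 0
  · -- `m` is a function of `s` alone, and `s = t` just renames the variable
    obtain ⟨⟨p, hp⟩, q, hq⟩ := lifts_of_dT_eq_zero hT
    have hev : ∀ g : Polynomial L, (g.map (RatFunc.C (K := L))).eval₂ (RingHom.id _) RatFunc.X =
        algebraMap _ (RatFunc L) g := by
      intro g
      rw [Polynomial.eval₂_map, RingHom.id_comp, ← RatFunc.aeval_X_left_eq_algebraMap,
        Polynomial.aeval_def, RatFunc.algebraMap_eq_C]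
    have hq0 : q ≠ 0 := by
      rintro rfl
      exact m.denom_ne_zero (by rw [hq, Polynomial.map_zero])
    have hmem : m ∈ specializable L (RatFunc.X : RatFunc L) := by
      change Polynomial.eval₂ _ _ _ ≠ 0
      rw [hq, hev]
      exact RatFunc.algebraMap_ne_zero hq0
    refine ⟨RatFunc.X, hmem, ?_⟩
    rintro ⟨c, hc⟩
    apply hm
    refine ⟨c, ?_⟩
    rw [specialize_apply, RatFunc.eval, hp, hq, hev, hev,
      div_eq_iff (RatFunc.algebraMap_ne_zero hq0), ← RatFunc.algebraMap_C, ← map_mul] at hc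
    have hpq := RatFunc.algebraMap_injective L hc
    rw [← RatFunc.num_div_denom m, div_eq_iff (RatFunc.algebraMap_ne_zero m.denom_ne_zero), hp, hq,
      hpq, IsScalarTower.algebraMap_apply L (RatFunc L) (RatFunc₂ L), RatFunc.algebraMap_eq_C,
      RatFunc.algebraMap_eq_C, ← RatFunc.algebraMap_C]
    simp
  · -- otherwise `s = l` works for all but finitely many constants `l`
    set a := m.num with ha
    set b := m.denom with hb
    have hb0 : b ≠ 0 := m.denom_ne_zero
    set d := coeffDeriv (dX L)
    have hw : b * d a - a * d b ≠ 0 := by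
      intro h0
      apply hT
      rw [← RatFunc.num_div_denom m, Derivation.leibniz_div, dT_algebraMap, dT_algebraMap,
        smul_eq_mul, smul_eq_mul, smul_eq_mul, ← map_mul, ← map_mul, ← map_sub, h0, map_zero,
        mul_zero]
    obtain ⟨l, hl⟩ : ∃ l : L, (b * (b * d a - a * d b)).eval (RatFunc.C l) ≠ 0 := by
      by_contra! hcon
      have hinf : (Set.range (RatFunc.C (K := L))).Infinite :=
        Set.infinite_range_of_injective RatFunc.C_injective
      refine mul_ne_zero hb0 hw (Polynomial.eq_zero_of_infinite_isRoot _ (hinf.mono ?_))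
      rintro _ ⟨l, rfl⟩
      exact hcon l
    rw [Polynomial.eval_mul] at hl
    have hd : ∀ p : Polynomial (RatFunc L),
        dX L (p.eval (RatFunc.C l)) = (d p).eval (RatFunc.C l) := by
      intro p
      rw [Polynomial.eval_eq_sum_range' (n := p.natDegree + 1) (Nat.lt_succ_self _),
        Polynomial.eval_eq_sum_range' (n := p.natDegree + 1) (p := d p), map_sum]
      · refine Finset.sum_congr rfl fun i _ => ?_
        rw [Derivation.leibniz, Derivation.leibniz_pow, dX_C, coeff_coeffDeriv]
        simp [mul_comm]
      · refine Nat.lt_succ_of_le (Polynomial.natDegree_le_iff_coeff_eq_zero.mpr fun N hN => ?_)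
        rw [coeff_coeffDeriv, Polynomial.coeff_eq_zero_of_natDegree_lt hN, map_zero]
    have hbl : b.eval (RatFunc.C l) ≠ 0 := left_ne_zero_of_mul hl
    refine ⟨RatFunc.C l, hbl, ?_⟩
    rintro ⟨c, hc⟩
    have h1 := congrArg (dX L) hc
    rw [specialize_apply, RatFunc.eval, dX_C, ← ha, ← hb, ← Polynomial.eval, ← Polynomial.eval,
      Derivation.leibniz_div, hd, hd] at h1
    refine right_ne_zero_of_mul hl ?_
    have h2 := (smul_eq_zero.mp h1).resolve_left (by simp [hbl])
    simpa using h2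

/-- A subfield of `L(s, t)` of transcendence degree one over `L` is the field of rational functions
of one element: a substitution `s = f(t)` embeds it in `L(t)`, where Lüroth's theorem applies. -/
theorem exists_algHom_fieldRange_eq [CharZero L] (M : IntermediateField L (RatFunc₂ L))
    {m : RatFunc₂ L} (hmM : m ∈ M) (hm : ¬ ∃ c : L, m = algebraMap L (RatFunc₂ L) c)
    (halg : ∀ y ∈ M, IsAlgebraic (IntermediateField.adjoin L {m}) y) :
    ∃ φ : RatFunc L →ₐ[L] RatFunc₂ L, φ.fieldRange = M := by
  obtain ⟨f, hmem, hf⟩ := exists_specialization hm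
  have hle : M.toSubalgebra ≤ specializable L f :=
    fun x hx => le_specializable ⟨m, hmem⟩ hf M halg hx
  let θ : M →ₐ[L] RatFunc L := (specialize L f).comp (Subalgebra.inclusion hle)
  have hN : θ.fieldRange ≠ ⊥ := by
    intro h
    have : θ ⟨m, hmM⟩ ∈ (⊥ : IntermediateField L (RatFunc L)) := h ▸ ⟨_, rfl⟩
    obtain ⟨c, hc⟩ := IntermediateField.mem_bot.mp this
    exact hf ⟨c, by rw [← RatFunc.algebraMap_eq_C]; exact hc.symm⟩
  let e := RatFunc.Luroth.algEquiv hN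
  let θ' : M ≃ₐ[L] θ.fieldRange := AlgEquiv.ofInjectiveField θ
  refine ⟨M.val.comp ((θ'.symm : θ.fieldRange →ₐ[L] M).comp (e : RatFunc L →ₐ[L] θ.fieldRange)), ?_⟩
  ext x
  constructor
  · rintro ⟨y, rfl⟩
    exact Subtype.property _
  · intro hx
    exact ⟨e.symm (θ' ⟨x, hx⟩), by simp⟩

end Specialization

end DevelopableSurface
end

noncomputable section
namespace DevelopableSurface
open MvPolynomial

/-! ### Gaussian curvature and the bordered Hessian -/

section Curvature

variable {L : Type*} [Field L] {E : Type*} [Field E] [Algebra L E]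

/-- The chain rule for a polynomial in three elements. -/
theorem derivation_aeval (D : Derivation L E E) (P : Fin 3 → E) (G : MvPolynomial (Fin 3) L) :
    D (aeval P G) = polyGradient G P ⬝ᵥ fun i => D (P i) := by
  unfold polyGradient dotProduct
  induction G using MvPolynomial.induction_on with
  | C a => simp
  | add p q hp hq =>
    simp only [map_add, hp, hq, add_mul, Finset.sum_add_distrib]
  | mul_X p i hp =>
    simp only [map_mul, aeval_X, Derivation.leibniz, smul_eq_mul, hp, map_add, pderiv_X]
    fin_cases i <;> simp [Fin.sum_univ_three] <;> ring

theorem pderiv_comm (F : MvPolynomial (Fin 3) L) (i j : Fin 3) :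
    pderiv i (pderiv j F) = pderiv j (pderiv i F) := by
  have h : ⁅pderiv (R := L) i, pderiv j⁆ = (0 : Derivation L (MvPolynomial (Fin 3) L) _) := by
    apply MvPolynomial.derivation_ext
    intro k
    rw [Derivation.commutator_apply, pderiv_X, pderiv_X]
    simp only [Pi.single_apply]
    split_ifs <;> simp
  have := DFunLike.congr_fun h F
  rw [Derivation.commutator_apply] at this
  exact sub_eq_zero.mp this

theorem hessian_comm (F : MvPolynomial (Fin 3) L) (p v w : Fin 3 → E) :
    hessian F p v w = hessian F p w v := by
  unfold hessian
  rw [Finset.sum_comm]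
  refine Finset.sum_congr rfl fun i _ => Finset.sum_congr rfl fun j _ => ?_
  rw [pderiv_comm]; ring

theorem hessian_add_smul (F : MvPolynomial (Fin 3) L) (p v w x : Fin 3 → E) (a b : E) :
    hessian F p (a • v + b • w) x = a * hessian F p v x + b * hessian F p w x := by
  unfold hessian
  simp only [Finset.mul_sum, ← Finset.sum_add_distrib]
  refine Finset.sum_congr rfl fun i _ => Finset.sum_congr rfl fun j _ => ?_
  simp only [Pi.add_apply, Pi.smul_apply, smul_eq_mul]; ring

/-- The derivative of the gradient is the Hessian. -/
theorem derivation_polyGradient_dotProduct (D : Derivation L E E) (F : MvPolynomial (Fin 3) L)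
    (P w : Fin 3 → E) :
    (fun i => D (polyGradient F P i)) ⬝ᵥ w = hessian F P (fun i => D (P i)) w := by
  unfold hessian
  rw [Finset.sum_comm, dotProduct]
  refine Finset.sum_congr rfl fun i _ => ?_
  simp only [polyGradient, derivation_aeval, dotProduct, Finset.sum_mul]

/-- On the tangent plane, the determinant of the Hessian form is the bordered Hessian up to a
square: both are values of the adjugate form of the Hessian, at `v × w` and at the gradient. -/
theorem hessian_det_eq (F : MvPolynomial (Fin 3) L) (p v w : Fin 3 → E) (c : E)
    (hc : crossProduct v w = c • polyGradient F p) :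
    hessian F p v v * hessian F p w w - hessian F p v w ^ 2 =
      - c ^ 2 * aeval p (borderedHessian F) := by
  have h0 := congrFun hc 0
  have h1 := congrFun hc 1
  have h2 := congrFun hc 2
  simp only [cross_apply, polyGradient, Pi.smul_apply, smul_eq_mul, Matrix.cons_val] at h0 h1 h2
  have hb : borderedHessian F =
      - ((pderiv 1 (pderiv 1 F) * pderiv 2 (pderiv 2 F) - pderiv 1 (pderiv 2 F) ^ 2)
            * pderiv 0 F ^ 2
        + (pderiv 0 (pderiv 0 F) * pderiv 2 (pderiv 2 F) - pderiv 0 (pderiv 2 F) ^ 2)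
            * pderiv 1 F ^ 2
        + (pderiv 0 (pderiv 0 F) * pderiv 1 (pderiv 1 F) - pderiv 0 (pderiv 1 F) ^ 2)
            * pderiv 2 F ^ 2
        + 2 * (pderiv 0 (pderiv 2 F) * pderiv 1 (pderiv 2 F)
            - pderiv 0 (pderiv 1 F) * pderiv 2 (pderiv 2 F)) * pderiv 0 F * pderiv 1 F
        + 2 * (pderiv 0 (pderiv 1 F) * pderiv 1 (pderiv 2 F)
            - pderiv 0 (pderiv 2 F) * pderiv 1 (pderiv 1 F)) * pderiv 0 F * pderiv 2 F
        + 2 * (pderiv 0 (pderiv 1 F) * pderiv 0 (pderiv 2 F)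
            - pderiv 1 (pderiv 2 F) * pderiv 0 (pderiv 0 F)) * pderiv 1 F * pderiv 2 F) := by
    unfold borderedHessian
    rw [pderiv_comm F 1 0, pderiv_comm F 2 0, pderiv_comm F 2 1]
    simp [Matrix.det_succ_row_zero, Fin.sum_univ_succ, Fin.succAbove]
    ring
  rw [hb]
  simp only [map_neg, map_add, map_sub, map_mul, map_pow, map_ofNat]
  unfold hessian
  simp only [Fin.sum_univ_three]
  rw [pderiv_comm F 1 0, pderiv_comm F 2 0, pderiv_comm F 2 1]
  generalize aeval p (pderiv 0 (pderiv 0 F)) = a at *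
  generalize aeval p (pderiv 0 (pderiv 1 F)) = b at *
  generalize aeval p (pderiv 0 (pderiv 2 F)) = d at *
  generalize aeval p (pderiv 1 (pderiv 1 F)) = e at *
  generalize aeval p (pderiv 1 (pderiv 2 F)) = f at *
  generalize aeval p (pderiv 2 (pderiv 2 F)) = g at *
  generalize aeval p (pderiv 0 F) = x at *
  generalize aeval p (pderiv 1 F) = y at *
  generalize aeval p (pderiv 2 F) = z at *
  -- the adjugate form, evaluated at `v × w = c ∇F`
  have : ∀ X Y Z : E, X = c * x → Y = c * y → Z = c * z →
      (e * g - f ^ 2) * X ^ 2 + (a * g - d ^ 2) * Y ^ 2 + (a * e - b ^ 2) * Z ^ 2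
      + 2 * (d * f - b * g) * X * Y + 2 * (b * f - d * e) * X * Z + 2 * (b * d - f * a) * Y * Z =
      c ^ 2 * ((e * g - f ^ 2) * x ^ 2 + (a * g - d ^ 2) * y ^ 2 + (a * e - b ^ 2) * z ^ 2
        + 2 * (d * f - b * g) * x * y + 2 * (b * f - d * e) * x * z
        + 2 * (b * d - f * a) * y * z) := by
    rintro X Y Z rfl rfl rfl
    ring
  have := this _ _ _ h0 h1 h2
  linear_combination this

/-- Vectors orthogonal to a nonzero vector `n` of `E³` have a cross product proportional to `n`. -/
theorem exists_cross_eq_smul {n v w : Fin 3 → E} (hn : n ≠ 0) (hv : n ⬝ᵥ v = 0)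
    (hw : n ⬝ᵥ w = 0) : ∃ c : E, crossProduct v w = c • n := by
  obtain ⟨i, hi⟩ := Function.ne_iff.mp hn
  simp only [dotProduct, Fin.sum_univ_three] at hv hw
  refine ⟨crossProduct v w i / n i, ?_⟩
  ext j
  simp only [cross_apply, Pi.smul_apply, smul_eq_mul]
  rw [div_mul_eq_mul_div, eq_div_iff hi]
  fin_cases i <;> fin_cases j <;> simp <;>
  first
  | linear_combination v 0 * hw - w 0 * hv
  | linear_combination v 1 * hw - w 1 * hv
  | linear_combination v 2 * hw - w 2 * hv
  | linear_combination -v 0 * hw + w 0 * hv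
  | linear_combination -v 1 * hw + w 1 * hv
  | linear_combination -v 2 * hw + w 2 * hv

/-- The plane orthogonal to `n ≠ 0` contains vectors whose cross product is a nonzero multiple of
`n`.  This holds also for isotropic `n`, with `n · n = 0`. -/
theorem exists_cross_eq_smul_self {n : Fin 3 → E} (hn : n ≠ 0) :
    ∃ (v w : Fin 3 → E) (c : E), c ≠ 0 ∧ n ⬝ᵥ v = 0 ∧ n ⬝ᵥ w = 0 ∧ crossProduct v w = c • n := by
  obtain ⟨i, hi⟩ := Function.ne_iff.mp hn
  fin_cases i
  · refine ⟨![-n 1, n 0, 0], ![-n 2, 0, n 0], n 0, hi, ?_, ?_, ?_⟩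
    · simp [dotProduct, Fin.sum_univ_three]; ring
    · simp [dotProduct, Fin.sum_univ_three]; ring
    · ext j; fin_cases j <;> simp [cross_apply]; ring
  · refine ⟨![0, -n 2, n 1], ![n 1, -n 0, 0], n 1, hi, ?_, ?_, ?_⟩
    · simp [dotProduct, Fin.sum_univ_three]; ring
    · simp [dotProduct, Fin.sum_univ_three]; ring
    · ext j; fin_cases j <;> simp [cross_apply]; ring
  · refine ⟨![n 2, 0, -n 0], ![0, n 2, -n 1], n 2, hi, ?_, ?_, ?_⟩
    · simp [dotProduct, Fin.sum_univ_three]; ring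
    · simp [dotProduct, Fin.sum_univ_three]; ring
    · ext j; fin_cases j <;> simp [cross_apply]; ring

theorem borderedHessian_eq_zero_of_polyGradient_eq_zero (F : MvPolynomial (Fin 3) L)
    (p : Fin 3 → E) (h : polyGradient F p = 0) : aeval p (borderedHessian F) = 0 := by
  have h' : ∀ i, aeval p (pderiv i F) = 0 := fun i => congrFun h i
  have : aeval p (borderedHessian F) = ((aeval p : _ →ₐ[L] E) : _ →+* E) (borderedHessian F) := rfl
  rw [this, borderedHessian, RingHom.map_det]
  apply Matrix.det_eq_zero_of_row_eq_zero 3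
  intro j
  fin_cases j <;> simp [h']

/-- Zero Gaussian curvature is the vanishing of the bordered Hessian.  At singular points there is
no condition on either side, since the last row of the determinant is zero. -/
theorem hasZeroGaussianCurvature_iff (F : MvPolynomial (Fin 3) L) :
    HasZeroGaussianCurvature E F ↔ ∀ p ∈ surface E F, aeval p (borderedHessian F) = 0 := by
  constructor
  · intro h p hp
    by_cases hn : polyGradient F p = 0
    · exact borderedHessian_eq_zero_of_polyGradient_eq_zero F p hn
    · obtain ⟨v, w, c, hc, hv, hw, hcr⟩ := exists_cross_eq_smul_self hn
      have := h p hp hn v w hv hw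
      rw [hessian_det_eq F p v w c hcr] at this
      simpa [hc] using this
  · intro h p hp hn v w hv hw
    obtain ⟨c, hc⟩ := exists_cross_eq_smul hn hv hw
    rw [hessian_det_eq F p v w c hc, h p hp, mul_zero]

/-- Where the bordered Hessian vanishes, the second fundamental form has a kernel. -/
theorem exists_hessian_kernel (F : MvPolynomial (Fin 3) L) (p v w : Fin 3 → E)
    (hn : polyGradient F p ≠ 0) (hb : aeval p (borderedHessian F) = 0)
    (hv : polyGradient F p ⬝ᵥ v = 0) (hw : polyGradient F p ⬝ᵥ w = 0) :
    ∃ a b : E, (a, b) ≠ 0 ∧ hessian F p (a • v + b • w) v = 0 ∧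
      hessian F p (a • v + b • w) w = 0 := by
  obtain ⟨c, hc⟩ := exists_cross_eq_smul hn hv hw
  have h := hessian_det_eq F p v w c hc
  rw [hb, mul_zero] at h
  simp only [hessian_add_smul]
  rw [hessian_comm F p w v]
  by_cases h0 : hessian F p v v = 0 ∧ hessian F p v w = 0
  · exact ⟨1, 0, by simp, by simp [h0], by simp [h0]⟩
  · refine ⟨-hessian F p v w, hessian F p v v, fun hab => h0 ?_, by ring, by linear_combination h⟩
    rw [Prod.mk_eq_zero, neg_eq_zero] at hab
    exact hab.symm

end Curvature
end DevelopableSurface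
end

noncomputable section
namespace DevelopableSurface
open MvPolynomial

/-! ### The tangent planes of a parametrized surface of curvature zero -/

section LinearAlgebra

variable {E : Type*} [Field E]

theorem eq_smul_of_cross_eq_zero {v w : Fin 3 → E} (h : crossProduct v w = 0) {i : Fin 3}
    (hi : v i ≠ 0) : w = (w i / v i) • v := by
  have h0 := congrFun h 0
  have h1 := congrFun h 1
  have h2 := congrFun h 2
  simp only [cross_apply, Matrix.cons_val, Pi.zero_apply] at h0 h1 h2
  ext j
  rw [Pi.smul_apply, smul_eq_mul, div_mul_eq_mul_div, eq_div_iff hi]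
  fin_cases i <;> fin_cases j <;> simp <;>
  first
  | ring1
  | linear_combination h0
  | linear_combination h1
  | linear_combination h2
  | linear_combination -h0
  | linear_combination -h1
  | linear_combination -h2

theorem eq_smul_of_orthogonal {v w x y : Fin 3 → E} (h : crossProduct v w ≠ 0)
    (hxv : x ⬝ᵥ v = 0) (hxw : x ⬝ᵥ w = 0) (hyv : y ⬝ᵥ v = 0) (hyw : y ⬝ᵥ w = 0) (hy : y ≠ 0) :
    ∃ c : E, x = c • y := by
  rcases eq_or_ne x 0 with rfl | hx
  · exact ⟨0, by simp⟩
  obtain ⟨a, ha⟩ := exists_cross_eq_smul hx hxv hxw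
  obtain ⟨b, hb⟩ := exists_cross_eq_smul hy hyv hyw
  have ha0 : a ≠ 0 := by
    rintro rfl
    exact h (by simpa using ha)
  exact ⟨a⁻¹ * b, by rw [mul_smul, ← hb, ha, smul_smul, inv_mul_cancel₀ ha0, one_smul]⟩

end LinearAlgebra

section Kernel

variable {L : Type*} [Field L]

/-- By the Nullstellensatz, the polynomials that vanish on a parametrization of `F = 0` are the
multiples of `F`. -/
theorem aeval_eq_zero_iff_dvd {K : Type*} [Field K] [IsAlgClosed K] [Algebra L K]
    {E : Type*} [Field E] [Algebra L E] {F : MvPolynomial (Fin 3) L} (hF : Squarefree F)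
    {P : Fin 3 → E} (hP : IsParametrization (L := L) P (surface K F)) (G : MvPolynomial (Fin 3) L) :
    aeval P G = 0 ↔ F ∣ G := by
  have hS : surface K F = zeroLocus K (Ideal.span {F}) := by
    rw [zeroLocus_span]; simp [surface]
  have hprime : (RingHom.ker (aeval P : MvPolynomial (Fin 3) L →ₐ[L] E)).IsPrime :=
    RingHom.ker_isPrime _
  have h := congrArg (vanishingIdeal L) (hS.symm.trans hP)
  rw [vanishingIdeal_zeroLocus_eq_radical, IsPrime.vanishingIdeal_zeroLocus] at h
  have hrad : (Ideal.span {F}).IsRadical := by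
    rw [← isRadical_iff_span_singleton]
    exact hF.isRadical
  rw [hrad.radical] at h
  rw [← Ideal.mem_span_singleton, h, RingHom.mem_ker]

variable {E : Type*} [Field E] [Algebra L E] {F : MvPolynomial (Fin 3) L} {P : Fin 3 → E}

theorem exists_degreeOf_pos {σ B : Type*} [CommRing B] [Nontrivial B] [Algebra L B]
    {q : σ → B} {G : MvPolynomial σ L} (hG0 : G ≠ 0) (hq : aeval q G = 0) :
    ∃ k, 0 < degreeOf k G := by
  by_contra! h
  have hv : G.vars = ∅ := by
    ext i
    simp [mem_vars_iff_degreeOf_ne_zero, Nat.le_zero.mp (h i)]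
  have hC := vars_eq_empty_iff_eq_C.mp hv
  rw [hC, aeval_C, map_eq_zero] at hq
  exact hG0 (by rw [hC, hq, map_zero])

/-- If `F` involves the variable `x_k`, the other two coordinates of a generic point of `F = 0` are
algebraically independent. -/
theorem algebraicIndependent_of_degreeOf_pos (hF0 : F ≠ 0) (hP : ∀ G, aeval P G = 0 ↔ F ∣ G)
    {k : Fin 3} (hk : 0 < degreeOf k F) : AlgebraicIndependent L fun i => P (k.succAbove i) := by
  rw [algebraicIndependent_iff]
  intro g hg
  have h1 : F ∣ rename k.succAbove g := by
    rw [← hP, aeval_rename]; exact hg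
  obtain ⟨q, hq⟩ := h1
  by_contra hg0
  have hr : rename k.succAbove g ≠ 0 := by
    rwa [ne_eq, map_eq_zero_iff _ (rename_injective _ Fin.succAbove_right_injective)]
  have hq0 : q ≠ 0 := by
    rintro rfl
    exact hr (by rw [hq, mul_zero])
  have hd : degreeOf k (rename k.succAbove g) = 0 := by
    by_contra h
    have := vars_rename k.succAbove g (mem_vars_iff_degreeOf_ne_zero.mpr h)
    simp [Fin.succAbove_ne] at this
  rw [hq, degreeOf_mul_eq hF0 hq0] at hd
  omega

theorem pderiv_ne_zero [CharZero L] {σ : Type*} {G : MvPolynomial σ L} {k : σ}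
    (hk : 0 < degreeOf k G) : pderiv k G ≠ 0 := by
  obtain ⟨m, hm, hmk⟩ : ∃ m ∈ G.support, m k = degreeOf k G := by
    by_contra! hne
    have : degreeOf k G < degreeOf k G := (degreeOf_lt_iff hk).mpr fun m hm =>
      lt_of_le_of_ne (monomial_le_degreeOf k hm) (hne m hm)
    exact lt_irrefl _ this
  intro h0
  have := coeff_pderiv (i := k) G (m - Finsupp.single k 1)
  rw [h0, coeff_zero, tsub_add_cancel_of_le (by
    rw [Finsupp.single_le_iff]; omega)] at this
  have h1 : ((m - Finsupp.single k 1 : σ →₀ ℕ) k : L) + 1 ≠ 0 := Nat.cast_add_one_ne_zero _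
  exact (mul_ne_zero (mem_support_iff.mp hm) h1) this.symm

theorem totalDegree_pderiv_lt {σ : Type*} {G : MvPolynomial σ L} {k : σ}
    (hk : pderiv k G ≠ 0) : (pderiv k G).totalDegree < G.totalDegree := by
  have h : ∀ m ∈ (pderiv k G).support, (m.sum fun _ e => e) + 1 ≤ G.totalDegree := by
    intro m hm
    rw [mem_support_iff, coeff_pderiv] at hm
    have := le_totalDegree (mem_support_iff.mpr (left_ne_zero_of_mul hm))
    rwa [Finsupp.sum_add_index' (fun _ => rfl) (fun _ _ _ => rfl), Finsupp.sum_single_index rfl]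
      at this
  obtain ⟨m, hm⟩ := support_nonempty.mpr hk
  exact (Finset.sup_lt_iff (by have := h m hm; simp; omega)).mpr fun m hm => h m hm

/-- The gradient does not vanish at a generic point: a partial derivative has lower degree than `F`,
so it is not a multiple of `F`. -/
theorem polyGradient_ne_zero [CharZero L] (hF0 : F ≠ 0) (hP : ∀ G, aeval P G = 0 ↔ F ∣ G) :
    polyGradient F P ≠ 0 := by
  obtain ⟨k, hk⟩ := exists_degreeOf_pos hF0 ((hP F).mpr dvd_rfl)
  intro h
  obtain ⟨q, hq⟩ := (hP _).mp (congrFun h k)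
  have hne := pderiv_ne_zero hk
  have hlt := totalDegree_pderiv_lt hne
  have hq0 : q ≠ 0 := by
    rintro rfl
    exact hne (by rw [hq, mul_zero])
  rw [hq, totalDegree_mul_of_isDomain hF0 hq0] at hlt
  omega

/-- The two partial derivatives of a parametrization of a surface are linearly independent: a
derivation that kills the coordinates of `P`, two of which are algebraically independent, is
zero. -/
theorem jacobian_injective [CharZero L] {P : Fin 3 → RatFunc₂ L} (hF0 : F ≠ 0)
    (hP : ∀ G, aeval P G = 0 ↔ F ∣ G) {a b : RatFunc₂ L}
    (h : ∀ i, a * dS L (P i) + b * dT L (P i) = 0) : a = 0 ∧ b = 0 := by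
  obtain ⟨k, hk⟩ := exists_degreeOf_pos hF0 ((hP F).mpr dvd_rfl)
  have hi := algebraicIndependent_of_degreeOf_pos hF0 hP hk
  have := derivation_eq_zero_of_algebraicIndependent (a • dS L + b • dT L) hi
    (fun i => by simpa using h _)
  refine ⟨by simpa using this sVar, ?_⟩
  have h1 : (inT 1 : RatFunc₂ L) = 1 := map_one RatFunc.C
  simpa [h1] using this (inT RatFunc.X)

/-- Curvature zero: in a suitable direction `a ∂/∂s + b ∂/∂t` the gradient changes only by a
factor. -/
theorem exists_derivation_polyGradient [CharZero L] {P : Fin 3 → RatFunc₂ L} (hF0 : F ≠ 0)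
    (hP : ∀ G, aeval P G = 0 ↔ F ∣ G) (hb : F ∣ borderedHessian F) :
    ∃ a b c : RatFunc₂ L, (a, b) ≠ 0 ∧
      ∀ i, (a • dS L + b • dT L) (polyGradient F P i) = c * polyGradient F P i := by
  set n := polyGradient F P with hn
  have hn0 : n ≠ 0 := polyGradient_ne_zero hF0 hP
  have hF : aeval P F = 0 := (hP F).mpr dvd_rfl
  set v : Fin 3 → RatFunc₂ L := fun i => dS L (P i) with hv
  set w : Fin 3 → RatFunc₂ L := fun i => dT L (P i) with hw
  have hnv : n ⬝ᵥ v = 0 := by rw [← derivation_aeval, hF, map_zero]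
  have hnw : n ⬝ᵥ w = 0 := by rw [← derivation_aeval, hF, map_zero]
  obtain ⟨a, b, hab, h1, h2⟩ := exists_hessian_kernel F P v w hn0 ((hP _).mpr hb) hnv hnw
  set D := a • dS L + b • dT L with hD
  have hDP : (fun i => D (P i)) = a • v + b • w := by
    ext i; simp [hD, hv, hw]
  have hcr : crossProduct v w ≠ 0 := by
    intro h0
    have hv0 : v ≠ 0 := by
      intro h
      have := jacobian_injective hF0 hP (a := 1) (b := 0) fun i => by
        simpa using congrFun h i
      exact one_ne_zero this.1
    obtain ⟨i, hi⟩ := Function.ne_iff.mp hv0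
    have hwv := eq_smul_of_cross_eq_zero h0 hi
    have := jacobian_injective hF0 hP (a := - (w i / v i)) (b := 1) fun j => by
      have := congrFun hwv j
      simp only [Pi.smul_apply, smul_eq_mul] at this
      change -(w i / v i) * v j + 1 * w j = 0
      linear_combination this
    exact one_ne_zero this.2
  obtain ⟨c, hc⟩ := eq_smul_of_orthogonal (x := fun i => D (n i)) hcr
    (by rw [hn, derivation_polyGradient_dotProduct, hDP, h1])
    (by rw [hn, derivation_polyGradient_dotProduct, hDP, h2]) hnv hnw hn0
  exact ⟨a, b, c, hab, fun i => congrFun hc i⟩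

/-- The tangent plane `ν · x = c` at a generic point of a surface of curvature zero, normalized by
`ν_j = 1`, is constant along a vector field of the parameter plane. -/
theorem exists_tangent_plane [CharZero L] {P : Fin 3 → RatFunc₂ L} (hF0 : F ≠ 0)
    (hP : ∀ G, aeval P G = 0 ↔ F ∣ G) (hb : F ∣ borderedHessian F) :
    ∃ (ν : Fin 3 → RatFunc₂ L) (j : Fin 3), ν j = 1 ∧
      ν ⬝ᵥ (fun i => dS L (P i)) = 0 ∧ ν ⬝ᵥ (fun i => dT L (P i)) = 0 ∧
      (∀ i, ν i ∈ IntermediateField.adjoin L (Set.range P)) ∧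
      ∃ a b : RatFunc₂ L, (a, b) ≠ 0 ∧ ∀ i, (a • dS L + b • dT L) (ν i) = 0 := by
  obtain ⟨a, b, c, hab, hD⟩ := exists_derivation_polyGradient hF0 hP hb
  have hn0 : polyGradient F P ≠ 0 := polyGradient_ne_zero hF0 hP
  have hF : aeval P F = 0 := (hP F).mpr dvd_rfl
  obtain ⟨j, hj⟩ := Function.ne_iff.mp hn0
  rw [Pi.zero_apply] at hj
  have hν : ∀ w : Fin 3 → RatFunc₂ L, polyGradient F P ⬝ᵥ w = 0 →
      (fun i => polyGradient F P i / polyGradient F P j) ⬝ᵥ w = 0 := by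
    intro w hw
    have : (fun i => polyGradient F P i / polyGradient F P j) =
        (polyGradient F P j)⁻¹ • polyGradient F P := by
      ext i; simp [div_eq_inv_mul]
    rw [this, smul_dotProduct, hw, smul_zero]
  have hmem : ∀ i, polyGradient F P i ∈ IntermediateField.adjoin L (Set.range P) := by
    intro i
    have h : (aeval P (pderiv i F)) ∈ (aeval P : _ →ₐ[L] RatFunc₂ L).range := ⟨_, rfl⟩
    rw [← Algebra.adjoin_range_eq_range_aeval] at h
    exact IntermediateField.algebra_adjoin_le_adjoin _ _ h
  refine ⟨fun i => polyGradient F P i / polyGradient F P j, j, div_self hj,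
    hν _ (by rw [← derivation_aeval, hF, map_zero]),
    hν _ (by rw [← derivation_aeval, hF, map_zero]),
    fun i => div_mem (hmem i) (hmem j), a, b, hab, fun i => ?_⟩
  rw [Derivation.leibniz_div, hD, hD]
  simp only [smul_eq_mul]
  ring

end Kernel

end DevelopableSurface
end

noncomputable section
namespace DevelopableSurface
open MvPolynomial

/-! ### The family of lines on the surface -/

section LineFamily

/-- The numerator of the point, with `k`-th coordinate zero, of the line `n · x = c`,
`n' · x = c'`; the denominator is the `k`-th coordinate of `n × n'`. -/
def lineBase {E : Type*} [Field E] (n n' : Fin 3 → E) (c c' : E) (k : Fin 3) : Fin 3 → E :=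
  c • crossProduct n' (Pi.single k 1) + c' • crossProduct (Pi.single k 1) n

section Field

variable {E : Type*} [Field E] (n n' : Fin 3 → E) (c c' : E) (k : Fin 3)

theorem lineBase_apply_self : lineBase n n' c c' k k = 0 := by
  fin_cases k <;> simp [lineBase, cross_apply]

theorem dotProduct_lineBase : n ⬝ᵥ lineBase n n' c c' k = c * crossProduct n n' k := by
  fin_cases k <;> simp [lineBase, cross_apply, dotProduct, Fin.sum_univ_three] <;> ring

theorem dotProduct_lineBase' : n' ⬝ᵥ lineBase n n' c c' k = c' * crossProduct n n' k := by
  fin_cases k <;> simp [lineBase, cross_apply, dotProduct, Fin.sum_univ_three] <;> ring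

variable {n n' c c'} in
theorem mul_cross_eq_lineBase_add {p : Fin 3 → E} (h : n ⬝ᵥ p = c) (h' : n' ⬝ᵥ p = c')
    (i : Fin 3) :
    p i * crossProduct n n' k = lineBase n n' c c' k i + p k * crossProduct n n' i := by
  subst h h'
  fin_cases k <;> fin_cases i <;>
    simp [lineBase, cross_apply, dotProduct, Fin.sum_univ_three] <;> ring

end Field

theorem map_cross {E E' : Type*} [CommRing E] [CommRing E'] (φ : E →+* E') (v w : Fin 3 → E)
    (i : Fin 3) : φ (crossProduct v w i) = crossProduct (φ ∘ v) (φ ∘ w) i := by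
  fin_cases i <;> simp [cross_apply]

theorem map_lineBase {E E' : Type*} [Field E] [Field E'] (φ : E →+* E') (n n' : Fin 3 → E)
    (c c' : E) (k i : Fin 3) :
    φ (lineBase n n' c c' k i) = lineBase (φ ∘ n) (φ ∘ n') (φ c) (φ c') k i := by
  have h : φ ∘ (Pi.single k 1 : Fin 3 → E) = Pi.single k 1 := by
    ext l
    simp only [Function.comp_apply, Pi.single_apply]
    split_ifs <;> simp
  simp only [lineBase, Pi.add_apply, Pi.smul_apply, smul_eq_mul, map_add, map_mul, map_cross, h]

variable {L : Type*} [Field L]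

/-- The derivative of a curve in `L(t)³`. -/
def curveDeriv (v : Fin 3 → RatFunc L) : Fin 3 → RatFunc L := fun i => dX L (v i)

theorem derivation_dotProduct {R E : Type*} [Field R] [Field E] [Algebra R E]
    (D : Derivation R E E) (v w : Fin 3 → E) :
    D (v ⬝ᵥ w) = (fun i => D (v i)) ⬝ᵥ w + v ⬝ᵥ fun i => D (w i) := by
  simp only [dotProduct, map_sum, Derivation.leibniz, smul_eq_mul, Finset.sum_add_distrib]
  rw [add_comm]
  congr 1
  exact Finset.sum_congr rfl fun i _ => mul_comm _ _

theorem dX_dotProduct (v w : Fin 3 → RatFunc L) :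
    dX L (v ⬝ᵥ w) = curveDeriv v ⬝ᵥ w + v ⬝ᵥ curveDeriv w :=
  derivation_dotProduct _ _ _

/-- Up to a common factor, a subfield of `L(t)` is stable under differentiation: by Lüroth's
theorem it is `L(w)`, and the factor is the derivative of `w`. -/
theorem exists_dX_div_mem [CharZero L] (M : IntermediateField L (RatFunc L)) :
    ∃ r : RatFunc L, r ≠ 0 ∧ ∀ f ∈ M, dX L f / r ∈ M := by
  by_cases hM : M = ⊥
  · refine ⟨1, one_ne_zero, fun f hf => ?_⟩
    rw [hM] at hf
    obtain ⟨c, rfl⟩ := IntermediateField.mem_bot.mp hf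
    simp
  · let e := RatFunc.Luroth.algEquiv hM
    let φ : RatFunc L →ₐ[L] RatFunc L := M.val.comp (e : RatFunc L →ₐ[L] M)
    have hφ : ∀ f ∈ M, ∃ g, φ g = f := fun f hf => ⟨e.symm ⟨f, hf⟩, by simp [φ]⟩
    refine ⟨dX L (φ RatFunc.X), fun h0 => hM (eq_bot_iff.mpr fun f hf => ?_), fun f hf => ?_⟩
    · obtain ⟨g, rfl⟩ := hφ f hf
      have := derivation_algHom (dX L) φ g
      rw [h0, zero_mul] at this
      obtain ⟨c, hc⟩ := eq_C_of_dX_eq_zero this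
      rw [hc, ← RatFunc.algebraMap_eq_C]
      exact IntermediateField.algebraMap_mem _ c
    · obtain ⟨g, rfl⟩ := hφ f hf
      rw [derivation_algHom]
      by_cases h0 : dX L (φ RatFunc.X) = 0
      · simp [h0]
      · rw [mul_div_cancel_left₀ _ h0]
        exact Subtype.property _

/-- A normalized normal vector of two independent vectors is rational in their coordinates. -/
theorem normal_mem {E : Type*} [Field E] [Algebra L E] (M : IntermediateField L E)
    {x y N : Fin 3 → E} (hx : ∀ i, x i ∈ M) (hy : ∀ i, y i ∈ M) (hxy : crossProduct x y ≠ 0)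
    {j : Fin 3} (hj : N j = 1) (hNx : N ⬝ᵥ x = 0) (hNy : N ⬝ᵥ y = 0) (i : Fin 3) : N i ∈ M := by
  have hN : N ≠ 0 := by
    rintro rfl
    simp at hj
  obtain ⟨c, hc⟩ := exists_cross_eq_smul hN hNx hNy
  have hcj := congrFun hc j
  rw [Pi.smul_apply, hj, smul_eq_mul, mul_one] at hcj
  have hc0 : c ≠ 0 := by
    rintro rfl
    exact hxy (by simpa using hc)
  have hm : ∀ i, crossProduct x y i ∈ M := by
    intro i
    fin_cases i <;> simp only [cross_apply] <;>
      exact sub_mem (mul_mem (hx _) (hy _)) (mul_mem (hx _) (hy _))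
  have : N i = crossProduct x y i / c := by
    rw [hc, Pi.smul_apply, smul_eq_mul, mul_div_cancel_left₀ _ hc0]
  rw [this, ← hcj]
  exact div_mem (hm i) (hm j)

/-- If `L(t)` is generated by the plane `N · x = c`, it is generated by the coordinates of a point
`z` of this plane together with a direction `x` and the derivative of a curve `y` that are parallel
to the plane. -/
theorem eq_top_of_plane [CharZero L] (M : IntermediateField L (RatFunc L))
    {x y z N : Fin 3 → RatFunc L} (hx : ∀ i, x i ∈ M) (hy : ∀ i, y i ∈ M) (hz : ∀ i, z i ∈ M)
    (hxy : crossProduct x (curveDeriv y) ≠ 0) {j : Fin 3} (hj : N j = 1) (hNx : N ⬝ᵥ x = 0)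
    (hNy : N ⬝ᵥ curveDeriv y = 0)
    (htop : IntermediateField.adjoin L (insert (N ⬝ᵥ z) (Set.range N)) = ⊤) : M = ⊤ := by
  obtain ⟨r, hr, hrM⟩ := exists_dX_div_mem M
  have hN : ∀ i, N i ∈ M := by
    refine normal_mem M hx (y := r⁻¹ • curveDeriv y) (fun i => ?_) ?_ hj hNx ?_
    · have := hrM _ (hy i)
      rwa [div_eq_inv_mul] at this
    · rw [map_smul]
      exact smul_ne_zero (inv_ne_zero hr) hxy
    · rw [dotProduct_smul, hNy, smul_zero]
  rw [← top_le_iff, ← htop, IntermediateField.adjoin_le_iff]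
  rintro _ (rfl | ⟨i, rfl⟩)
  · exact sum_mem fun i _ => mul_mem (hN i) (hz i)
  · exact hN i

open IntermediateField.algebraAdjoinAdjoin in
/-- The tangent plane `ν · x = c` of a surface of curvature zero either is one fixed plane or moves
in a family, rational in one parameter `φ(t)`. -/
theorem exists_dual_curve [CharZero L] {P : Fin 3 → RatFunc₂ L}
    {ν : Fin 3 → RatFunc₂ L} {j : Fin 3} (hj : ν j = 1)
    (hS : ν ⬝ᵥ (fun i => dS L (P i)) = 0) (hT : ν ⬝ᵥ (fun i => dT L (P i)) = 0)
    (hmem : ∀ i, ν i ∈ IntermediateField.adjoin L (Set.range P))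
    {a b : RatFunc₂ L} (hab : (a, b) ≠ 0) (hD : ∀ i, (a • dS L + b • dT L) (ν i) = 0) :
    (∃ n : Fin 3 → L, ∀ i, ν i = algebraMap L (RatFunc₂ L) (n i)) ∨
    ∃ (φ : RatFunc L →ₐ[L] RatFunc₂ L) (N : Fin 3 → RatFunc L) (c : RatFunc L),
      φ RatFunc.X ∈ IntermediateField.adjoin L (Set.range P) ∧ N j = 1 ∧ curveDeriv N ≠ 0 ∧
      IntermediateField.adjoin L (insert c (Set.range N)) = ⊤ ∧
      (φ ∘ N) ⬝ᵥ P = φ c ∧ (φ ∘ curveDeriv N) ⬝ᵥ P = φ (dX L c) := by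
  by_cases hall : ∀ i, ∃ c : L, ν i = algebraMap L (RatFunc₂ L) c
  · left
    choose n hn using hall
    exact ⟨n, hn⟩
  right
  push Not at hall
  obtain ⟨i₀, hi₀⟩ := hall
  have hi₀' : ¬ ∃ c : L, ν i₀ = algebraMap L (RatFunc₂ L) c := by push Not; exact hi₀
  set D := a • dS L + b • dT L with hDdef
  have hDP : ν ⬝ᵥ (fun i => D (P i)) = 0 := by
    have : (fun i => D (P i)) = a • (fun i => dS L (P i)) + b • fun i => dT L (P i) := by
      ext i; simp [hDdef]
    rw [this, dotProduct_add, dotProduct_smul, dotProduct_smul, hS, hT]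
    simp
  set M := IntermediateField.adjoin L (insert (ν ⬝ᵥ P) (Set.range ν)) with hM
  have hMD : M ≤ constants D := by
    rw [hM, IntermediateField.adjoin_le_iff]
    rintro _ (rfl | ⟨i, rfl⟩)
    · change D _ = 0
      rw [derivation_dotProduct, hDP, funext hD]
      simp [dotProduct]
    · exact hD i
  have hνM : ∀ i, ν i ∈ M := fun i =>
    IntermediateField.subset_adjoin _ _ (Set.mem_insert_of_mem _ ⟨i, rfl⟩)
  have hcM : ν ⬝ᵥ P ∈ M := IntermediateField.subset_adjoin _ _ (Set.mem_insert _ _)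
  have htr : Transcendental L (ν i₀) := by
    intro h
    have h' : IsAlgebraic (⊥ : IntermediateField L (RatFunc₂ L)) (ν i₀) := h.tower_top _
    have hbot : ∀ (δ : Derivation L (RatFunc₂ L) (RatFunc₂ L)), δ (ν i₀) = 0 := fun δ =>
      derivation_eq_zero_of_isAlgebraic δ ⊥ (fun m hm => by
        obtain ⟨c, rfl⟩ := IntermediateField.mem_bot.mp hm
        exact δ.map_algebraMap c) h'
    exact hi₀' (exists_algebraMap_eq (hbot _) (hbot _))
  -- two independent constants of the nonzero derivation `D` would make `L(s, t)` algebraic over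
  -- its field of constants
  have halg : ∀ y ∈ M, IsAlgebraic (IntermediateField.adjoin L {ν i₀}) y := by
    intro y hy
    by_contra hy'
    have h1 : AlgebraicIndependent L (fun _ : Unit => ν i₀) :=
      algebraicIndependent_unique_type_iff.mpr htr
    have h2 : AlgebraicIndependent L (fun o : Option Unit => o.elim y fun _ => ν i₀) := by
      rw [h1.option_iff_transcendental]
      intro h
      apply hy'
      rw [Set.range_const] at h
      exact (IsFractionRing.isAlgebraic_iff (Algebra.adjoin L {ν i₀})
        (IntermediateField.adjoin L {ν i₀}) (RatFunc₂ L)).mp h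
    let e : Fin 2 ≃ Option Unit := Fintype.equivOfCardEq (by simp)
    have h3 := derivation_eq_zero_of_algebraicIndependent D (h2.comp e e.injective) (by
      intro i
      simp only [Function.comp_apply]
      rcases e i with _ | _
      · exact hMD hy
      · exact hD i₀)
    apply hab
    have ha : a = 0 := by simpa [hDdef] using h3 sVar
    have hb : b = 0 := by
      have h1 : (inT 1 : RatFunc₂ L) = 1 := map_one RatFunc.C
      simpa [hDdef, h1] using h3 (inT RatFunc.X)
    rw [ha, hb]; rfl
  obtain ⟨φ, hφ⟩ := exists_algHom_fieldRange_eq M (hνM i₀) hi₀' halg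
  have hr : ∀ x ∈ M, ∃ y, φ y = x := fun x hx => by rw [← hφ] at hx; exact hx
  choose N hN using fun i => hr _ (hνM i)
  obtain ⟨c, hc⟩ := hr _ hcM
  have hφN : φ ∘ N = ν := funext hN
  -- one of the two partial derivatives does not kill the parameter
  obtain ⟨δ, hδP, hδ⟩ : ∃ δ : Derivation L (RatFunc₂ L) (RatFunc₂ L),
      ν ⬝ᵥ (fun i => δ (P i)) = 0 ∧ δ (ν i₀) ≠ 0 := by
    by_contra! hcon
    exact hi₀' (exists_algebraMap_eq (hcon _ hS) (hcon _ hT))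
  have hchain := derivation_algHom δ φ
  have hu : δ (φ RatFunc.X) ≠ 0 := by
    intro h0
    apply hδ
    rw [← hN, hchain, h0, zero_mul]
  refine ⟨φ, N, c, ?_, ?_, ?_, ?_, by rw [hφN, hc], ?_⟩
  · have hle : M ≤ IntermediateField.adjoin L (Set.range P) := by
      rw [hM, IntermediateField.adjoin_le_iff]
      rintro _ (rfl | ⟨i, rfl⟩)
      · exact sum_mem fun i _ =>
          mul_mem (hmem i) (IntermediateField.subset_adjoin _ _ ⟨i, rfl⟩)
      · exact hmem i
    apply hle
    rw [← hφ]
    exact ⟨_, rfl⟩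
  · have h : φ (N j) = φ 1 := by rw [hN, hj, map_one]
    exact φ.injective h
  · intro h0
    apply hδ
    have : dX L (N i₀) = 0 := congrFun h0 i₀
    rw [← hN, hchain, this, map_zero, mul_zero]
  · apply IntermediateField.map_injective φ
    rw [IntermediateField.adjoin_map, ← AlgHom.fieldRange_eq_map, hφ, hM, Set.image_insert_eq, hc,
      ← Set.range_comp, hφN]
  · apply mul_left_cancel₀ hu
    rw [← hchain, hc, derivation_dotProduct, hδP, add_zero, ← smul_eq_mul, ← smul_dotProduct]
    congr 1
    ext i
    rw [Pi.smul_apply, smul_eq_mul, ← hN i, hchain (N i)]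
    rfl

end LineFamily
end DevelopableSurface
end

noncomputable section
namespace DevelopableSurface
open MvPolynomial

/-! ### Cylinders, cones and tangent surfaces -/

section Classification

variable {L : Type*} [Field L]

/-- A parametrization `X(t) + s Y(t)` of a cylinder: the direction `Y` is constant, and `X`
generates `L(t)` and lies in a coordinate plane transversal to `Y`. -/
def IsCylinderForm (X Y : Fin 3 → RatFunc L) : Prop :=
  ∃ (b : Fin 3 → L) (k : Fin 3), (∀ i, Y i = RatFunc.C (b i)) ∧ b k = 1 ∧ X k = 0 ∧
    IntermediateField.adjoin L (Set.range X) = ⊤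

/-- A parametrization `X(t) + s Y(t)` of a cone: the point `X` is constant, and `Y` generates
`L(t)` and lies in a coordinate plane not through the origin. -/
def IsConeForm (X Y : Fin 3 → RatFunc L) : Prop :=
  ∃ (r : Fin 3 → L) (k : Fin 3), (∀ i, X i = RatFunc.C (r i)) ∧ Y k = 1 ∧
    IntermediateField.adjoin L (Set.range Y) = ⊤

/-- A parametrization `X(t) + s Y(t)` of a tangent surface: `Y` is the derivative of `X`, the curve
`X` generates `L(t)`, and its osculating plane is not constant. -/
def IsTangentForm (X Y : Fin 3 → RatFunc L) : Prop :=
  Y = curveDeriv X ∧ IntermediateField.adjoin L (Set.range X) = ⊤ ∧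
    crossProduct (curveDeriv X) (curveDeriv (curveDeriv X)) ≠ 0 ∧
    ∃ (N : Fin 3 → RatFunc L) (j : Fin 3), N j = 1 ∧ curveDeriv N ≠ 0 ∧
      N ⬝ᵥ curveDeriv X = 0 ∧ curveDeriv N ⬝ᵥ curveDeriv X = 0

theorem curveDeriv_add_smul (A B : Fin 3 → RatFunc L) (f : RatFunc L) :
    curveDeriv (A + f • B) = curveDeriv A + f • curveDeriv B + dX L f • B := by
  ext i
  simp [curveDeriv, Derivation.leibniz]
  ring

/-- A surface with a fixed tangent plane is a plane, and is parametrized as a cylinder. -/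
theorem exists_form_of_plane [CharZero L] {P : Fin 3 → RatFunc₂ L}
    (hJ : ∀ a b : RatFunc₂ L, (∀ i, a * dS L (P i) + b * dT L (P i) = 0) → a = 0 ∧ b = 0)
    {n : Fin 3 → L} {j : Fin 3} (hj : n j = 1)
    (hS : (fun i => algebraMap L (RatFunc₂ L) (n i)) ⬝ᵥ (fun i => dS L (P i)) = 0)
    (hT : (fun i => algebraMap L (RatFunc₂ L) (n i)) ⬝ᵥ (fun i => dT L (P i)) = 0) :
    ∃ (φ : RatFunc L →ₐ[L] RatFunc₂ L) (X Y : Fin 3 → RatFunc L) (τ : RatFunc₂ L),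
      φ RatFunc.X ∈ IntermediateField.adjoin L (Set.range P) ∧
      (∀ i, P i = φ (X i) + τ * φ (Y i)) ∧ IsCylinderForm X Y := by
  obtain ⟨k, l, hkl⟩ : ∃ k l : Fin 3, k ≠ j ∧ l ≠ j ∧ k ≠ l ∧
      ∀ f : Fin 3 → RatFunc₂ L, ∑ i, f i = f j + f k + f l := by
    fin_cases j
    · exact ⟨1, 2, by decide, by decide, by decide, fun f => by simp [Fin.sum_univ_three]⟩
    · exact ⟨0, 2, by decide, by decide, by decide,
        fun f => by simp [Fin.sum_univ_three]; ring⟩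
    · exact ⟨0, 1, by decide, by decide, by decide,
        fun f => by simp [Fin.sum_univ_three]; ring⟩
  obtain ⟨hk, hl, hkl, hsum⟩ := hkl
  have hcase : ∀ i, i = j ∨ i = k ∨ i = l := by omega
  simp only [dotProduct, hsum, hj, map_one, one_mul] at hS hT
  -- the equation of the plane
  obtain ⟨c, hc⟩ : ∃ c : L, P j + algebraMap L (RatFunc₂ L) (n k) * P k +
      algebraMap L (RatFunc₂ L) (n l) * P l = algebraMap L (RatFunc₂ L) c := by
    apply exists_algebraMap_eq
    · simpa [Derivation.leibniz] using hS
    · simpa [Derivation.leibniz] using hT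
  have hJ' : ¬ (dS L (P l) = 0 ∧ dT L (P l) = 0) := by
    rintro ⟨h1, h2⟩
    rw [h1, mul_zero, add_zero] at hS
    rw [h2, mul_zero, add_zero] at hT
    have h3 := hJ (dT L (P k)) (-dS L (P k)) fun i => by
      rcases hcase i with rfl | rfl | rfl
      · linear_combination dT L (P k) * hS - dS L (P k) * hT
      · ring
      · rw [h1, h2]; ring
    have h4 := hJ 0 1 fun i => by
      rcases hcase i with rfl | rfl | rfl
      · rw [h3.1, mul_zero, add_zero] at hT
        rw [hT]; ring
      · rw [h3.1]; ring
      · rw [h2]; ring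
    exact one_ne_zero h4.2
  have htr : Transcendental L (P l) := by
    intro h
    have h' : IsAlgebraic (⊥ : IntermediateField L (RatFunc₂ L)) (P l) := h.tower_top _
    have hbot : ∀ (δ : Derivation L (RatFunc₂ L) (RatFunc₂ L)), δ (P l) = 0 := fun δ =>
      derivation_eq_zero_of_isAlgebraic δ ⊥ (fun m hm => by
        obtain ⟨c, rfl⟩ := IntermediateField.mem_bot.mp hm
        exact δ.map_algebraMap c) h'
    exact hJ' ⟨hbot _, hbot _⟩
  let φ : RatFunc L →ₐ[L] RatFunc₂ L := (IntermediateField.adjoin L {P l}).val.comp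
    (RatFunc.algEquivOfTranscendental (P l) htr).toAlgHom
  have hφ : φ RatFunc.X = P l := RatFunc.algEquivOfTranscendental_X (P l) htr
  have hφC : ∀ a : L, φ (RatFunc.C a) = algebraMap L (RatFunc₂ L) a := by
    intro a; rw [← RatFunc.algebraMap_eq_C]; exact φ.commutes a
  refine ⟨φ, fun i => if i = j then RatFunc.C c - RatFunc.C (n l) * RatFunc.X
      else if i = k then 0 else RatFunc.X,
    fun i => RatFunc.C (if i = j then - n k else if i = k then 1 else 0), P k, ?_, ?_,
    ⟨_, k, fun i => rfl, by simp [hk], by simp [hk], ?_⟩⟩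
  · rw [hφ]; exact IntermediateField.subset_adjoin _ _ ⟨l, rfl⟩
  · intro i
    rcases hcase i with rfl | rfl | rfl
    · simp only [if_true, map_sub, map_mul, hφC, hφ, map_neg]
      linear_combination hc
    · simp [hk]
    · simp [hl, hkl.symm, hφ]
  · rw [← top_le_iff, ← RatFunc.adjoin_X, IntermediateField.adjoin_le_iff,
      Set.singleton_subset_iff]
    exact IntermediateField.subset_adjoin _ _ ⟨l, by simp [hl, hkl.symm]⟩

/-- A surface whose tangent planes `N · x = c` move in one-parameter family is a cylinder, a cone or
a tangent surface.  The lines on it are the intersections of the planes with their derivatives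
`N' · x = c'`; with direction `B` and base point `A` normalized to `B_k = 1` and `A_k = 0`, the
derivatives `A'` and `B'` are orthogonal to `N` and to the `k`-th axis, so they are proportional. -/
theorem exists_form_of_dual_curve [CharZero L] {P : Fin 3 → RatFunc₂ L}
    (hJ : ∀ a b : RatFunc₂ L, (∀ i, a * dS L (P i) + b * dT L (P i) = 0) → a = 0 ∧ b = 0)
    (φ : RatFunc L →ₐ[L] RatFunc₂ L) {N : Fin 3 → RatFunc L} {c : RatFunc L} {j : Fin 3}
    (hj : N j = 1) (hN : curveDeriv N ≠ 0)
    (htop : IntermediateField.adjoin L (insert c (Set.range N)) = ⊤)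
    (h : (φ ∘ N) ⬝ᵥ P = φ c) (h' : (φ ∘ curveDeriv N) ⬝ᵥ P = φ (dX L c)) :
    ∃ (X Y : Fin 3 → RatFunc L) (τ : RatFunc₂ L),
      (∀ i, P i = φ (X i) + τ * φ (Y i)) ∧
      (IsCylinderForm X Y ∨ IsConeForm X Y ∨ IsTangentForm X Y) := by
  set W := crossProduct N (curveDeriv N) with hW
  have hW0 : W ≠ 0 := by
    intro h0
    have := eq_smul_of_cross_eq_zero h0 (i := j) (by rw [hj]; exact one_ne_zero)
    have hj' : curveDeriv N j = 0 := by simp [curveDeriv, hj]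
    rw [hj', zero_div, zero_smul] at this
    exact hN this
  obtain ⟨k, hk⟩ := Function.ne_iff.mp hW0
  rw [Pi.zero_apply] at hk
  set A : Fin 3 → RatFunc L := (W k)⁻¹ • lineBase N (curveDeriv N) c (dX L c) k with hA
  set B : Fin 3 → RatFunc L := (W k)⁻¹ • W with hB
  have hAk : A k = 0 := by simp [hA, lineBase_apply_self]
  have hBk : B k = 1 := by simp [hB, hk]
  have hNB : N ⬝ᵥ B = 0 := by rw [hB, dotProduct_smul, hW, dot_self_cross, smul_zero]
  have hNB' : curveDeriv N ⬝ᵥ B = 0 := by rw [hB, dotProduct_smul, hW, dot_cross_self, smul_zero]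
  have hNA : N ⬝ᵥ A = c := by
    rw [hA, dotProduct_smul, dotProduct_lineBase, smul_eq_mul, ← hW]; field_simp
  have hNA' : curveDeriv N ⬝ᵥ A = dX L c := by
    rw [hA, dotProduct_smul, dotProduct_lineBase', smul_eq_mul, ← hW]; field_simp
  have hP : ∀ i, P i = φ (A i) + P k * φ (B i) := by
    intro i
    have h1 := mul_cross_eq_lineBase_add k h h' i
    have h2 := fun i => map_cross (φ : RatFunc L →+* RatFunc₂ L) N (curveDeriv N) i
    have h3 := map_lineBase (φ : RatFunc L →+* RatFunc₂ L) N (curveDeriv N) c (dX L c) k i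
    simp only [RingHom.coe_coe] at h2 h3
    rw [← h2, ← h2, ← h3] at h1
    have h4 : φ (W k) ≠ 0 := by simpa using hk
    simp only [hA, hB, Pi.smul_apply, smul_eq_mul, map_mul, map_inv₀]
    field_simp
    linear_combination h1
  clear_value A B
  have hdB : N ⬝ᵥ curveDeriv B = 0 := by
    have := dX_dotProduct N B
    rw [hNB, hNB', map_zero, zero_add] at this
    exact this.symm
  have hdA : N ⬝ᵥ curveDeriv A = 0 := by
    have := dX_dotProduct N A
    rw [hNA, hNA'] at this
    linear_combination -this
  have hdAk : curveDeriv A k = 0 := by simp [curveDeriv, hAk]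
  have hdBk : curveDeriv B k = 0 := by simp [curveDeriv, hBk]
  have hcross : ∀ y : Fin 3 → RatFunc L, y k = 0 → y ≠ 0 → crossProduct B y ≠ 0 := by
    intro y hy hy0 h0
    have := eq_smul_of_cross_eq_zero h0 (i := k) (by rw [hBk]; exact one_ne_zero)
    rw [hy, zero_div, zero_smul] at this
    exact hy0 this
  have hconst : ∀ v : Fin 3 → RatFunc L, curveDeriv v = 0 →
      ∃ b : Fin 3 → L, ∀ i, v i = RatFunc.C (b i) := by
    intro v hv
    choose b hb using fun i => eq_C_of_dX_eq_zero (congrFun hv i)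
    exact ⟨b, hb⟩
  have hCmem : ∀ (M : IntermediateField L (RatFunc L)) (a : L), RatFunc.C a ∈ M := by
    intro M a
    rw [← RatFunc.algebraMap_eq_C]; exact M.algebraMap_mem a
  by_cases hB0 : curveDeriv B = 0
  · obtain ⟨b, hb⟩ := hconst B hB0
    have hbk : b k = 1 := by
      apply RatFunc.C_injective (K := L)
      rw [← hb, hBk, map_one]
    refine ⟨A, B, P k, hP, Or.inl ⟨b, k, hb, hbk, hAk, ?_⟩⟩
    -- otherwise the surface would degenerate to a single line
    have hA0 : curveDeriv A ≠ 0 := by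
      intro hA0
      obtain ⟨a, ha⟩ := hconst A hA0
      have hφC : ∀ (δ : Derivation L (RatFunc₂ L) (RatFunc₂ L)) (a : L),
          δ (φ (RatFunc.C a)) = 0 := by
        intro δ a
        rw [← RatFunc.algebraMap_eq_C, φ.commutes]; exact δ.map_algebraMap a
      have hδ : ∀ (δ : Derivation L (RatFunc₂ L) (RatFunc₂ L)) i,
          δ (P i) = φ (B i) * δ (P k) := by
        intro δ i
        rw [hP i, ha, hb, map_add, Derivation.leibniz, hφC, hφC]
        simp
      have h3 := hJ (dT L (P k)) (-dS L (P k)) fun i => by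
        rw [hδ (dS L) i, hδ (dT L) i]; ring
      have h4 := hJ 0 1 fun i => by
        rw [hδ (dT L) i, h3.1]; ring
      exact one_ne_zero h4.2
    exact eq_top_of_plane _ (x := B) (y := A) (z := A) (fun i => by rw [hb]; exact hCmem _ _)
      (fun i => IntermediateField.subset_adjoin _ _ ⟨i, rfl⟩)
      (fun i => IntermediateField.subset_adjoin _ _ ⟨i, rfl⟩) (hcross _ hdAk hA0) hj hNB hdA
      (by rw [hNA]; exact htop)
  · have hNk : crossProduct N (Pi.single k 1) ≠ 0 := by
      intro h0
      have h1 := eq_smul_of_cross_eq_zero h0 (i := j) (by rw [hj]; exact one_ne_zero)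
      have h2 := congrArg (fun v => v ⬝ᵥ B) h1
      simp [hNB, hBk] at h2
    obtain ⟨β, hβ⟩ := eq_smul_of_orthogonal (x := curveDeriv A) (y := curveDeriv B) hNk
      (by rw [dotProduct_comm, hdA]) (by simp [hdAk]) (by rw [dotProduct_comm, hdB])
      (by simp [hdBk]) hB0
    -- the point of the line that moves in the direction of the line
    set R : Fin 3 → RatFunc L := A + (-β) • B with hR
    have hdR : curveDeriv R = (-dX L β) • B := by
      rw [hR, curveDeriv_add_smul, hβ, map_neg]
      ext i
      simp only [Pi.add_apply, Pi.smul_apply, smul_eq_mul]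
      ring
    have hNR : N ⬝ᵥ R = c := by
      rw [hR, dotProduct_add, dotProduct_smul, hNA, hNB, smul_zero, add_zero]
    have hPR : ∀ i, P i = φ (R i) + (P k + φ β) * φ (B i) := by
      intro i
      simp only [hR, Pi.add_apply, Pi.smul_apply, smul_eq_mul, map_add, map_mul, map_neg]
      linear_combination hP i
    by_cases hβ0 : dX L β = 0
    · rw [hβ0, neg_zero, zero_smul] at hdR
      obtain ⟨r, hr⟩ := hconst R hdR
      refine ⟨R, B, _, hPR, Or.inr (Or.inl ⟨r, k, hr, hBk, ?_⟩)⟩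
      exact eq_top_of_plane _ (x := B) (y := B) (z := R)
        (fun i => IntermediateField.subset_adjoin _ _ ⟨i, rfl⟩)
        (fun i => IntermediateField.subset_adjoin _ _ ⟨i, rfl⟩)
        (fun i => by rw [hr]; exact hCmem _ _) (hcross _ hdBk hB0) hj hNB hdB
        (by rw [hNR]; exact htop)
    · have hβ1 : φ (dX L β) ≠ 0 := by simpa using hβ0
      have hddR : curveDeriv (curveDeriv R) =
          (-dX L β) • curveDeriv B + dX L (-dX L β) • B := by
        rw [hdR]
        have := curveDeriv_add_smul 0 B (-dX L β)
        rw [zero_add] at this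
        rw [this]
        have h0 : curveDeriv (0 : Fin 3 → RatFunc L) = 0 := by ext i; simp [curveDeriv]
        rw [h0, zero_add]
      refine ⟨R, curveDeriv R, -(P k + φ β) / φ (dX L β), fun i => ?_,
        Or.inr (Or.inr ⟨rfl, ?_, ?_, N, j, hj, hN, ?_, ?_⟩)⟩
      · rw [hdR, hPR i]
        simp only [Pi.smul_apply, smul_eq_mul, map_mul, map_neg]
        field_simp
      · set M := IntermediateField.adjoin L (Set.range R) with hM
        have hRM : ∀ i, R i ∈ M := fun i => IntermediateField.subset_adjoin _ _ ⟨i, rfl⟩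
        obtain ⟨r, hr, hrM⟩ := exists_dX_div_mem M
        have hBM : ∀ i, B i ∈ M := by
          intro i
          have h1 : ∀ i, dX L (R i) = -dX L β * B i := fun i => congrFun hdR i
          have h2 : B i = (dX L (R i) / r) / (dX L (R k) / r) := by
            rw [h1, h1, hBk]
            field_simp
          rw [h2]
          exact div_mem (hrM _ (hRM i)) (hrM _ (hRM k))
        exact eq_top_of_plane _ (x := B) (y := B) (z := R) hBM hBM hRM (hcross _ hdBk hB0) hj hNB
          hdB (by rw [hNR]; exact htop)
      · rw [hddR, hdR]
        simp only [map_smul, map_add, LinearMap.smul_apply, cross_self, smul_zero, add_zero]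
        exact smul_ne_zero (neg_ne_zero.mpr hβ0) (smul_ne_zero (neg_ne_zero.mpr hβ0)
          (hcross _ hdBk hB0))
      · rw [hdR, dotProduct_smul, hNB, smul_zero]
      · rw [hdR, dotProduct_smul, hNB', smul_zero]

/-- A surface of curvature zero with a rational parametrization is a cylinder, a cone or a tangent
surface. -/
theorem exists_form [CharZero L] {F : MvPolynomial (Fin 3) L} {P : Fin 3 → RatFunc₂ L}
    (hF0 : F ≠ 0) (hP : ∀ G, aeval P G = 0 ↔ F ∣ G) (hb : F ∣ borderedHessian F) :
    ∃ (φ : RatFunc L →ₐ[L] RatFunc₂ L) (X Y : Fin 3 → RatFunc L) (τ : RatFunc₂ L),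
      φ RatFunc.X ∈ IntermediateField.adjoin L (Set.range P) ∧
      (∀ i, P i = φ (X i) + τ * φ (Y i)) ∧
      (IsCylinderForm X Y ∨ IsConeForm X Y ∨ IsTangentForm X Y) := by
  obtain ⟨ν, j, hj, hS, hT, hmem, a, b, hab, hD⟩ := exists_tangent_plane hF0 hP hb
  have hJ : ∀ a b : RatFunc₂ L, (∀ i, a * dS L (P i) + b * dT L (P i) = 0) → a = 0 ∧ b = 0 :=
    fun a b h => jacobian_injective hF0 hP h
  rcases exists_dual_curve hj hS hT hmem hab hD with ⟨n, hn⟩ | ⟨φ, N, c, hX, hNj, hN, htop, h, h'⟩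
  · obtain rfl : ν = fun i => algebraMap L (RatFunc₂ L) (n i) := funext hn
    obtain ⟨φ, X, Y, τ, h1, h2, h3⟩ := exists_form_of_plane hJ
      ((algebraMap L (RatFunc₂ L)).injective (hj.trans (map_one _).symm)) hS hT
    exact ⟨φ, X, Y, τ, h1, h2, Or.inl h3⟩
  · obtain ⟨X, Y, τ, h2, h3⟩ := exists_form_of_dual_curve hJ φ hNj hN htop h h'
    exact ⟨φ, X, Y, τ, hX, h2, h3⟩

end Classification
end DevelopableSurface
end

noncomputable section
namespace DevelopableSurface
open MvPolynomial

/-! ### From lines to proper parametrizations -/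

section Proper

variable {L : Type*} [Field L]

/-- The parametrization `X(t) + s Y(t)` of a ruled surface. -/
def ruledParam (X Y : Fin 3 → RatFunc L) : Fin 3 → RatFunc₂ L :=
  fun i => inT (X i) + sVar * inT (Y i)

/-- The inclusion of `L(t)` in `L(s, t)`, as an `L`-algebra homomorphism. -/
def inTHom : RatFunc L →ₐ[L] RatFunc₂ L := IsScalarTower.toAlgHom L (RatFunc L) (RatFunc₂ L)

theorem inTHom_apply (f : RatFunc L) : inTHom f = inT f := by
  rw [inT, ← RatFunc.algebraMap_eq_C]; rfl

theorem inT_mem {M : IntermediateField L (RatFunc₂ L)} (ht : inT RatFunc.X ∈ M) (f : RatFunc L) :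
    inT f ∈ M := by
  have h1 : (⊤ : IntermediateField L (RatFunc L)).map inTHom ≤ M := by
    rw [← RatFunc.adjoin_X, IntermediateField.adjoin_map, IntermediateField.adjoin_le_iff,
      Set.image_singleton, Set.singleton_subset_iff, inTHom_apply]
    exact ht
  rw [← inTHom_apply]
  exact h1 ⟨f, trivial, rfl⟩

theorem eq_top_of_sVar_mem {M : IntermediateField L (RatFunc₂ L)}
    (ht : inT RatFunc.X ∈ M) (hs : sVar ∈ M) : M = ⊤ := by
  have hp : ∀ p : Polynomial (RatFunc L), algebraMap _ (RatFunc₂ L) p ∈ M := by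
    intro p
    rw [← RatFunc.aeval_X_left_eq_algebraMap, Polynomial.aeval_eq_sum_range]
    refine sum_mem fun i _ => ?_
    rw [RatFunc.smul_eq_C_mul]
    exact mul_mem (inT_mem ht _) (pow_mem hs i)
  rw [eq_top_iff]
  intro x _
  rw [← RatFunc.num_div_denom x]
  exact div_mem (hp _) (hp _)

/-- A parametrization of the form `φ(X) + τ φ(Y)` with independent partial derivatives is the image
of `X + s Y` under an embedding of `L(s, t)` in itself that extends `φ` and sends `s` to `τ`. -/
theorem ruledParam_form [CharZero L] {P : Fin 3 → RatFunc₂ L}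
    (hJ : ∀ a b : RatFunc₂ L, (∀ i, a * dS L (P i) + b * dT L (P i) = 0) → a = 0 ∧ b = 0)
    (φ : RatFunc L →ₐ[L] RatFunc₂ L) {X Y : Fin 3 → RatFunc L} {τ : RatFunc₂ L}
    (hP : ∀ i, P i = φ (X i) + τ * φ (Y i)) :
    ∃ Φ : RatFunc₂ L →ₐ[L] RatFunc₂ L,
      (∀ f, Φ (inT f) = φ f) ∧ Φ sVar = τ ∧ ∀ i, Φ (ruledParam X Y i) = P i := by
  set u := φ RatFunc.X with hu
  set D := dT L u • dS L - dS L u • dT L with hD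
  have hφD : ∀ f, D (φ f) = 0 := by
    intro f
    rw [derivation_algHom, ← hu]
    simp [hD]
    left; ring
  -- `τ` is transcendental over `L(u)`: otherwise the derivation `D`, which kills `u`, kills `P`
  have hτ : ∀ p : Polynomial (RatFunc L), p.eval₂ (φ : RatFunc L →+* RatFunc₂ L) τ = 0 → p = 0 := by
    intro p hp
    by_contra hp0
    let g : RatFunc L →+* constants D :=
      RingHom.codRestrict (φ : RatFunc L →+* RatFunc₂ L) (constants D) hφD
    have halg : IsAlgebraic (constants D) τ := by
      refine ⟨p.map g, ?_, ?_⟩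
      · rwa [ne_eq, Polynomial.map_eq_zero]
      · rw [Polynomial.aeval_def, Polynomial.eval₂_map]
        exact hp
    have hDτ := derivation_eq_zero_of_isAlgebraic D (constants D) (fun m hm => hm) halg
    have h0 := hJ (dT L u) (-dS L u) fun i => by
      have : D (P i) = 0 := by
        rw [hP, map_add, Derivation.leibniz, hφD, hφD, hDτ]; simp
      simp only [hD, Derivation.coe_sub, Derivation.coe_smul, Pi.sub_apply, Pi.smul_apply,
        smul_eq_mul] at this
      linear_combination this
    obtain ⟨c, hc⟩ := exists_algebraMap_eq (neg_eq_zero.mp h0.2) h0.1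
    have h1 : φ RatFunc.X = φ (RatFunc.C c) := by
      rw [← RatFunc.algebraMap_eq_C, φ.commutes]; exact hc
    have h2 := congrArg (dX L) (φ.injective h1)
    simp at h2
  let ψ : Polynomial (RatFunc L) →+* RatFunc₂ L :=
    Polynomial.eval₂RingHom (φ : RatFunc L →+* RatFunc₂ L) τ
  have hψ : nonZeroDivisors (Polynomial (RatFunc L)) ≤
      (nonZeroDivisors (RatFunc₂ L)).comap ψ := by
    intro p hp
    rw [Submonoid.mem_comap, mem_nonZeroDivisors_iff_ne_zero]
    exact fun h => nonZeroDivisors.ne_zero hp (hτ p h)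
  have hC : ∀ f, RatFunc.liftRingHom ψ hψ (RatFunc.C f) = φ f := by
    intro f
    rw [RatFunc.liftRingHom_C]
    simp [ψ]
  have hs : RatFunc.liftRingHom ψ hψ RatFunc.X = τ := by
    rw [RatFunc.liftRingHom_X]
    simp [ψ]
  refine ⟨{ RatFunc.liftRingHom ψ hψ with
    commutes' := fun a => ?_ }, hC, hs, fun i => ?_⟩
  · have h : algebraMap L (RatFunc₂ L) a = RatFunc.C (RatFunc.C a) := by
      rw [IsScalarTower.algebraMap_apply L (RatFunc L) (RatFunc₂ L), RatFunc.algebraMap_eq_C,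
        RatFunc.algebraMap_eq_C]
    change RatFunc.liftRingHom ψ hψ (algebraMap L (RatFunc₂ L) a) = _
    rw [h, hC, ← h, ← RatFunc.algebraMap_eq_C, φ.commutes]
  · change RatFunc.liftRingHom ψ hψ (RatFunc.C (X i) + RatFunc.X * RatFunc.C (Y i)) = _
    rw [map_add, map_mul, hC, hC, hs, hP]

/-- If the parameters `u = φ(t)` and `τ` of the lines `φ(X) + τ φ(Y)` are rational functions of the
point `P`, then `X(t) + s Y(t)` is a proper parametrization with the same equation. -/
theorem ruledParam_proper [CharZero L] {P : Fin 3 → RatFunc₂ L}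
    (hJ : ∀ a b : RatFunc₂ L, (∀ i, a * dS L (P i) + b * dT L (P i) = 0) → a = 0 ∧ b = 0)
    (φ : RatFunc L →ₐ[L] RatFunc₂ L) {X Y : Fin 3 → RatFunc L} {τ : RatFunc₂ L}
    (hP : ∀ i, P i = φ (X i) + τ * φ (Y i))
    (hu : φ RatFunc.X ∈ IntermediateField.adjoin L (Set.range P)) :
    (∀ G : MvPolynomial (Fin 3) L, aeval (ruledParam X Y) G = 0 ↔ aeval P G = 0) ∧
      IntermediateField.adjoin L (Set.range (ruledParam X Y)) = ⊤ := by
  obtain ⟨Φ, hΦ, hs, hΦP⟩ := ruledParam_form hJ φ hP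
  have hcomp : Φ ∘ ruledParam X Y = P := funext hΦP
  refine ⟨fun G => ?_, ?_⟩
  · rw [← hcomp, show aeval (Φ ∘ ruledParam X Y) G = Φ (aeval (ruledParam X Y) G) from
      (MvPolynomial.comp_aeval_apply _ _ G).symm, map_eq_zero_iff Φ Φ.injective]
  · set M := IntermediateField.adjoin L (Set.range (ruledParam X Y)) with hM
    have hmap : M.map Φ = IntermediateField.adjoin L (Set.range P) := by
      rw [hM, IntermediateField.adjoin_map, ← Set.range_comp, hcomp]
    have ht : inT RatFunc.X ∈ M := by
      rw [← hmap, ← hΦ] at hu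
      obtain ⟨x, hx, hxu⟩ := hu
      rwa [← Φ.injective hxu]
    obtain ⟨i, hi⟩ : ∃ i, Y i ≠ 0 := by
      by_contra! hY
      have h0 : ∀ i, P i = φ (X i) := fun i => by rw [hP, hY, map_zero, mul_zero, add_zero]
      have hd : ∀ (δ : Derivation L (RatFunc₂ L) (RatFunc₂ L)) i,
          δ (P i) = δ (φ RatFunc.X) * φ (dX L (X i)) := fun δ i => by
        rw [h0, derivation_algHom]
      have h3 := hJ (dT L (φ RatFunc.X)) (-dS L (φ RatFunc.X)) fun i => by
        rw [hd (dS L) i, hd (dT L) i]; ring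
      have h4 := hJ 0 1 fun i => by
        rw [hd (dT L) i, h3.1]; ring
      exact one_ne_zero h4.2
    refine eq_top_of_sVar_mem ht ?_
    have hi' : (inT (Y i) : RatFunc₂ L) ≠ 0 := by
      rw [← inTHom_apply]; simpa using hi
    have : sVar = (ruledParam X Y i - inT (X i)) / inT (Y i) := by
      rw [ruledParam]; field_simp; ring
    rw [this]
    exact div_mem (sub_mem (IntermediateField.subset_adjoin _ _ ⟨i, rfl⟩) (inT_mem ht _))
      (inT_mem ht _)

end Proper

section Substitution

variable {L : Type*} [Field L]

/-- The restriction of a polynomial to the line `X(t) + s Y(t)`, as a polynomial in `s`. -/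
def linePoly (X Y : Fin 3 → RatFunc L) :
    MvPolynomial (Fin 3) L →ₐ[L] Polynomial (RatFunc L) :=
  aeval fun i => Polynomial.C (X i) + Polynomial.X * Polynomial.C (Y i)

theorem algebraMap_linePoly (X Y : Fin 3 → RatFunc L) (G : MvPolynomial (Fin 3) L) :
    algebraMap (Polynomial (RatFunc L)) (RatFunc₂ L) (linePoly X Y G) =
      aeval (ruledParam X Y) G := by
  let ι : Polynomial (RatFunc L) →ₐ[L] RatFunc₂ L := IsScalarTower.toAlgHom L _ _
  have hι : ∀ p, ι p = algebraMap (Polynomial (RatFunc L)) (RatFunc₂ L) p := fun p => rfl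
  rw [← hι, linePoly, MvPolynomial.comp_aeval_apply]
  congr 2
  funext i
  rw [hι]
  simp only [map_add, map_mul, RatFunc.algebraMap_C, RatFunc.algebraMap_X, ruledParam, inT, sVar]

theorem eval_linePoly (X Y : Fin 3 → RatFunc L) (G : MvPolynomial (Fin 3) L) (b : RatFunc L) :
    (linePoly X Y G).eval b = aeval (fun i => X i + b * Y i) G := by
  refine (MvPolynomial.comp_aeval_apply _
    ((Polynomial.aeval (R := RatFunc L) b).restrictScalars L) G).trans ?_
  congr 2
  funext i
  simp only [map_add, map_mul, AlgHom.restrictScalars_apply, Polynomial.aeval_C,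
    Polynomial.aeval_X, Algebra.algebraMap_self_apply]

/-- An equation of the ruled surface `X(t) + s Y(t)` holds for every value of `s` in every
`L(t)`-algebra. -/
theorem aeval_ruledParam_eq_zero {X Y : Fin 3 → RatFunc L} {F : MvPolynomial (Fin 3) L}
    (hF : aeval (ruledParam X Y) F = 0) {B : Type*} [CommRing B] [Algebra L B]
    (f : RatFunc L →ₐ[L] B) (b : B) : aeval (fun i => f (X i) + b * f (Y i)) F = 0 := by
  have h1 : linePoly X Y F = 0 := by
    apply RatFunc.algebraMap_injective (RatFunc L)
    rw [map_zero, algebraMap_linePoly, hF]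
  let g : Polynomial (RatFunc L) →ₐ[L] B := Polynomial.aevalTower f b
  have h2 := congrArg g h1
  rw [map_zero, linePoly, MvPolynomial.comp_aeval_apply] at h2
  rw [← h2]
  congr 2
  funext i
  simp only [g, map_add, map_mul, Polynomial.aevalTower_C, Polynomial.aevalTower_X]

/-- Substitution of polynomial expressions `θ(x, y)` in an equation: an identity that holds for a
generic point `P` and all `y` holds for every specialization `p` of `P` and all `y`. -/
theorem aeval_eval_eq_zero {K E : Type*} [Field K] [Algebra L K] [Field E] [Algebra L E]
    {P : Fin 3 → E} {p : Fin 3 → K}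
    (hp : p ∈ zeroLocus K (RingHom.ker (aeval P : MvPolynomial (Fin 3) L →ₐ[L] E)))
    (θ : Fin 3 → Polynomial (MvPolynomial (Fin 3) L)) (G : MvPolynomial (Fin 3) L)
    (h : aeval (fun i => Polynomial.mapAlgHom (aeval P : _ →ₐ[L] E) (θ i)) G = 0) (c : K) :
    aeval (fun i => ((θ i).map (aeval p : MvPolynomial (Fin 3) L →ₐ[L] K).toRingHom).eval c) G
      = 0 := by
  rw [← MvPolynomial.comp_aeval_apply] at h
  have h1 : Polynomial.mapAlgHom (aeval p : _ →ₐ[L] K) (aeval θ G) = 0 := by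
    ext i
    have h2 := congrArg (fun q => Polynomial.coeff q i) h
    simp only [Polynomial.coe_mapAlgHom, Polynomial.coeff_map, Polynomial.coeff_zero] at h2 ⊢
    exact hp _ h2
  have h3 := congrArg (Polynomial.aeval (R := K) c) h1
  rw [MvPolynomial.comp_aeval_apply, map_zero] at h3
  have h4 : ((Polynomial.aeval (R := K) c).restrictScalars L)
      (aeval (fun i => Polynomial.mapAlgHom (aeval p : _ →ₐ[L] K) (θ i)) G) = 0 := h3
  rw [MvPolynomial.comp_aeval_apply] at h4
  exact h4

end Substitution
end DevelopableSurface
end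

noncomputable section
namespace DevelopableSurface
open MvPolynomial

/-! ### Cylinders and cones and their plane sections -/

section Sections

variable {L : Type*} [Field L] {K : Type*} [Field K] [Algebra L K]
  {F : MvPolynomial (Fin 3) L} {X Y : Fin 3 → RatFunc L}

theorem mem_plane_single (k : Fin 3) (b : L) (q : Fin 3 → K) :
    q ∈ plane (basePoint K (Pi.single k (1 : L))) (algebraMap L K b) ↔ q k = algebraMap L K b := by
  have : basePoint K (Pi.single k (1 : L)) = Pi.single k 1 := by
    ext i
    simp only [basePoint, Pi.single_apply]
    split_ifs <;> simp
  change _ ⬝ᵥ q = _ ↔ _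
  rw [this, single_dotProduct, one_mul]

theorem inT_C (a : L) : (inT (RatFunc.C a) : RatFunc₂ L) = algebraMap L (RatFunc₂ L) a := by
  rw [← inTHom_apply, ← RatFunc.algebraMap_eq_C, AlgHom.commutes]

theorem aeval_eq_zero_of_mem_surface {P : Fin 3 → RatFunc₂ L}
    (hS : IsParametrization (L := L) P (surface K F)) {p : Fin 3 → K}
    (hp : p ∈ surface K F) {G : MvPolynomial (Fin 3) L} (hG : aeval P G = 0) : aeval p G = 0 := by
  rw [hS] at hp
  exact hp G hG

/-- The surface of a cylinder parametrization satisfies the cylindrical case: the section is by the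
coordinate plane that contains the base curve. -/
theorem cylindricalCase_of_form (hF : aeval (ruledParam X Y) F = 0)
    (hS : IsParametrization (L := L) (ruledParam X Y) (surface K F))
    (htop : IntermediateField.adjoin L (Set.range (ruledParam X Y)) = ⊤)
    (h : IsCylinderForm X Y) : CylindricalCase K F := by
  obtain ⟨b, k, hY, hbk, hXk, hX⟩ := h
  have hparam : cylinderParam b X = ruledParam X Y := by
    ext i; simp only [cylinderParam, ruledParam, hY]
  have hPk : ruledParam X Y k = sVar := by
    have h0 : (inT 0 : RatFunc₂ L) = 0 := map_zero RatFunc.C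
    rw [ruledParam, hXk, hY, hbk, inT_C, map_one, h0]; ring
  refine ⟨b, ⟨?_, ?_⟩, Pi.single k 1, 0, X, ?_, ⟨?_, hX⟩, by rw [hparam]; exact ⟨hS, htop⟩⟩
  · intro h0
    have := congrFun h0 k
    simp [basePoint, hbk] at this
  · rintro p hp _ ⟨c, rfl⟩
    rw [hS] at hp
    have := aeval_eval_eq_zero hp
      (fun i => Polynomial.C (MvPolynomial.X i) + Polynomial.X * Polynomial.C (C (b i))) F (by
        rw [← aeval_ruledParam_eq_zero hF
          ((Polynomial.CAlgHom (R := L) (A := RatFunc₂ L)).comp inTHom)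
          (Polynomial.C sVar + Polynomial.X)]
        congr 2
        funext i
        simp only [Polynomial.coe_mapAlgHom, Polynomial.map_C, Polynomial.map_X, RingHom.coe_coe,
          aeval_X, aeval_C, AlgHom.comp_apply, Polynomial.CAlgHom_apply, inTHom_apply, ruledParam,
          hY, inT_C, map_add, map_mul]
        ring) c
    change aeval _ F = 0
    rw [← this]
    congr 2
    funext i
    simp only [basePoint, Polynomial.map_add, Polynomial.map_C, Polynomial.map_mul,
      Polynomial.map_X, Polynomial.eval_add, Polynomial.eval_C, Polynomial.eval_mul,
      Polynomial.eval_X, AlgHom.toRingHom_eq_coe, RingHom.coe_coe, aeval_X, aeval_C,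
      Pi.add_apply, Pi.smul_apply, smul_eq_mul]
  · simp [hbk]
  · rw [IsParametrization]
    ext p
    rw [Set.mem_inter_iff, mem_plane_single, map_zero]
    constructor
    · rintro ⟨hp, hpk⟩ G hG
      have h1 := aeval_eq_zero_of_mem_surface hS hp
        (G := aeval (fun i => MvPolynomial.X i - MvPolynomial.X k * C (b i)) G) (by
          rw [MvPolynomial.comp_aeval_apply]
          have : (fun i => aeval (ruledParam X Y)
              (MvPolynomial.X i - MvPolynomial.X k * C (b i) : MvPolynomial (Fin 3) L)) =
              fun i => inTHom (X i) := by
            funext i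
            simp only [map_sub, map_mul, aeval_X, aeval_C, hPk, inTHom_apply]
            rw [ruledParam, hY, inT_C]; ring
          rw [this, ← MvPolynomial.comp_aeval_apply, (RingHom.mem_ker).mp hG, map_zero])
      rw [MvPolynomial.comp_aeval_apply] at h1
      rw [← h1]
      congr 2
      funext i
      simp [hpk]
    · intro hp
      refine ⟨hp F ?_, ?_⟩
      · have := aeval_ruledParam_eq_zero hF (AlgHom.id L (RatFunc L)) 0
        simpa using this
      · have := hp (MvPolynomial.X k) (by simp [RingHom.mem_ker, hXk])
        simpa using this

/-- The substitution `r + y (x - r)`: the homothety of centre `r` and ratio `y`. -/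
def coneSubst (r : Fin 3 → L) (i : Fin 3) : Polynomial (MvPolynomial (Fin 3) L) :=
  Polynomial.C (C (r i)) + Polynomial.X * Polynomial.C (MvPolynomial.X i - C (r i))

/-- An equation of the cone of apex `r` over the section of `G = 0` by the plane `x_k = r_k + 1`:
the denominators of `G (r + (x - r) / (x_k - r_k))` are cleared. -/
def coneEquation (r : Fin 3 → L) (k : Fin 3) (G : MvPolynomial (Fin 3) L) :
    MvPolynomial (Fin 3) L :=
  (Polynomial.reflect (aeval (coneSubst r) G).natDegree (aeval (coneSubst r) G)).eval
    (MvPolynomial.X k - C (r k))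

theorem aeval_coneEquation_eq_zero_iff {B : Type*} [Field B] [Algebra L B] (r : Fin 3 → L)
    (k : Fin 3) (G : MvPolynomial (Fin 3) L) (q : Fin 3 → B)
    (hq : q k - algebraMap L B (r k) ≠ 0) :
    aeval q (coneEquation r k G) = 0 ↔
      aeval (fun i => algebraMap L B (r i) +
        (q k - algebraMap L B (r k))⁻¹ * (q i - algebraMap L B (r i))) G = 0 := by
  set u := q k - algebraMap L B (r k) with hu
  set g := aeval (coneSubst r) G with hg
  have h1 : aeval q (coneEquation r k G) =
      (Polynomial.reflect g.natDegree g).eval₂ ((aeval q : _ →ₐ[L] B) : _ →+* B) u := by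
    have := Polynomial.hom_eval₂ (Polynomial.reflect g.natDegree g) (RingHom.id _)
      ((aeval q : MvPolynomial (Fin 3) L →ₐ[L] B) : _ →+* B) (MvPolynomial.X k - C (r k))
    rw [RingHom.comp_id] at this
    refine this.trans ?_
    congr 1
    simp [hu]
  have h2 : g.eval₂ ((aeval q : _ →ₐ[L] B) : _ →+* B) u⁻¹ =
      aeval (fun i => algebraMap L B (r i) + u⁻¹ * (q i - algebraMap L B (r i))) G := by
    refine (MvPolynomial.comp_aeval_apply (coneSubst r)
      (Polynomial.aevalTower (aeval q : MvPolynomial (Fin 3) L →ₐ[L] B) u⁻¹) G).trans ?_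
    congr 2
    funext i
    simp only [coneSubst, map_add, map_mul, Polynomial.aevalTower_C, Polynomial.aevalTower_X,
      map_sub, aeval_X, aeval_C]
  let : Invertible u⁻¹ := invertibleOfNonzero (inv_ne_zero hq)
  have h3 := Polynomial.eval₂_reflect_eq_zero_iff ((aeval q : _ →ₐ[L] B) : _ →+* B) u⁻¹
    g.natDegree g le_rfl
  rw [invOf_eq_inv, inv_inv] at h3
  rw [h1, h3, h2]

/-- The surface of a cone parametrization satisfies the conical case.  The points of the section
by the plane `x_k = r_k + 1` satisfy every equation of the curve `r + Y`, since the equations of the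
curve become equations of the cone after homogenization. -/
theorem conicalCase_of_form (hF : aeval (ruledParam X Y) F = 0)
    (hS : IsParametrization (L := L) (ruledParam X Y) (surface K F))
    (htop : IntermediateField.adjoin L (Set.range (ruledParam X Y)) = ⊤)
    (h : IsConeForm X Y) : ConicalCase K F := by
  obtain ⟨r, k, hX, hYk, hY⟩ := h
  set Q : Fin 3 → RatFunc L := fun i => RatFunc.C (r i) + Y i with hQ
  have hparam : coneParam r Q = ruledParam X Y := by
    ext i
    have h : inT (RatFunc.C (r i) + Y i) = (inT (RatFunc.C (r i)) + inT (Y i) : RatFunc₂ L) :=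
      map_add RatFunc.C _ _
    simp only [coneParam, ruledParam, hX, hQ, h]
    ring
  have h1 : (inT 1 : RatFunc₂ L) = 1 := map_one RatFunc.C
  have hPi : ∀ i, ruledParam X Y i = algebraMap L (RatFunc₂ L) (r i) + sVar * inT (Y i) := by
    intro i; rw [ruledParam, hX, inT_C]
  refine ⟨r, ?_, Pi.single k 1, r k + 1, Q, ?_, ?_, ⟨?_, ?_⟩, by rw [hparam]; exact ⟨hS, htop⟩⟩
  · rintro p hp _ ⟨c, rfl⟩
    rw [hS] at hp
    have := aeval_eval_eq_zero hp (coneSubst r) F (by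
        rw [← aeval_ruledParam_eq_zero hF
          ((Polynomial.CAlgHom (R := L) (A := RatFunc₂ L)).comp inTHom)
          (Polynomial.X * Polynomial.C sVar)]
        congr 2
        funext i
        simp only [coneSubst, Polynomial.coe_mapAlgHom, Polynomial.map_C, Polynomial.map_X,
          RingHom.coe_coe, map_sub, aeval_X, aeval_C,
          AlgHom.comp_apply, Polynomial.CAlgHom_apply, inTHom_apply, hPi, hX, inT_C, map_mul,
          map_add]
        ring) c
    change aeval _ F = 0
    rw [← this]
    congr 2
    funext i
    simp [basePoint, coneSubst]
  · intro h0
    have := congrFun h0 k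
    simp at this
  · rw [mem_plane_single, basePoint, map_add, map_one]
    simp
  · rw [IsParametrization]
    ext p
    rw [Set.mem_inter_iff, mem_plane_single]
    constructor
    · rintro ⟨hp, hpk⟩ G hG
      have hPk : ruledParam X Y k - algebraMap L (RatFunc₂ L) (r k) = sVar := by
        rw [hPi, hYk, h1]; ring
      have hs0 : (sVar : RatFunc₂ L) ≠ 0 := RatFunc.X_ne_zero
      have hpk' : p k - algebraMap L K (r k) = 1 := by rw [hpk, map_add, map_one]; ring
      have h2 := aeval_eq_zero_of_mem_surface hS hp (G := coneEquation r k G) (by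
        rw [aeval_coneEquation_eq_zero_iff r k G _ (by rw [hPk]; exact hs0), hPk]
        have : (fun i => algebraMap L (RatFunc₂ L) (r i) +
            (sVar : RatFunc₂ L)⁻¹ * (ruledParam X Y i - algebraMap L (RatFunc₂ L) (r i))) =
            fun i => inTHom (Q i) := by
          funext i
          rw [hPi, hQ, map_add, inTHom_apply, inTHom_apply, inT_C]
          field_simp
          ring
        rw [this, ← MvPolynomial.comp_aeval_apply, (RingHom.mem_ker).mp hG, map_zero])
      rw [aeval_coneEquation_eq_zero_iff r k G _ (by rw [hpk']; exact one_ne_zero), hpk'] at h2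
      rw [← h2]
      congr 2
      funext i
      simp
    · intro hp
      refine ⟨hp F ?_, ?_⟩
      · have := aeval_ruledParam_eq_zero hF (AlgHom.id L (RatFunc L)) 1
        simpa [hX] using this
      · have := hp (MvPolynomial.X k - C (r k + 1)) (by
          simp [RingHom.mem_ker, hQ, hYk])
        simpa [sub_eq_zero] using this
  · rw [← top_le_iff, ← hY, IntermediateField.adjoin_le_iff]
    rintro _ ⟨i, rfl⟩
    have h2 : Y i = Q i - RatFunc.C (r i) := by simp [hQ]
    rw [h2, ← RatFunc.algebraMap_eq_C]
    exact sub_mem (IntermediateField.subset_adjoin _ _ ⟨i, rfl⟩)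
      (IntermediateField.algebraMap_mem _ _)

end Sections
end DevelopableSurface
end

noncomputable section
namespace DevelopableSurface
open MvPolynomial

/-! ### The points of a rational curve over the base field -/

section CurvePoints

open Filter

variable {L : Type*} [Field L]

theorem eventually_mem_specializable (f : RatFunc L) :
    ∀ᶠ a in cofinite, f ∈ specializable L a := by
  rw [eventually_cofinite]
  refine (Polynomial.finite_setOfPred_isRoot f.denom_ne_zero).subset fun a ha => ?_
  exact not_not.mp ha

/-- A rational function that takes the value zero infinitely often is zero. -/
theorem eq_zero_of_frequently_eval {f : RatFunc L}
    (h : ∃ᶠ a in cofinite, RatFunc.eval (RingHom.id L) a f = 0) : f = 0 := by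
  by_contra hf
  have h1 := Polynomial.finite_setOfPred_isRoot (RatFunc.num_ne_zero hf)
  have h2 : ∀ᶠ a in cofinite, ¬ f.num.IsRoot a := by
    rw [eventually_cofinite]; simpa using h1
  refine h ((h2.and (eventually_mem_specializable f)).mono fun a ha h0 => ?_)
  exact (div_eq_zero_iff.mp h0).elim ha.1 ha.2

/-- The point of the rational curve `X` with parameter `a`. -/
def curvePoint (X : Fin 3 → RatFunc L) (a : L) : Fin 3 → L :=
  fun i => RatFunc.eval (RingHom.id L) a (X i)

/-- Outside finitely many poles, evaluation at `a` is compatible with polynomial expressions. -/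
theorem eventually_eval_aeval (X : Fin 3 → RatFunc L) :
    ∀ᶠ a in cofinite, ∀ G : MvPolynomial (Fin 3) L,
      RatFunc.eval (RingHom.id L) a (aeval X G) = aeval (curvePoint X a) G := by
  have h : ∀ᶠ a in cofinite, ∀ i, X i ∈ specializable L a :=
    eventually_all.mpr fun i => eventually_mem_specializable (X i)
  refine h.mono fun a ha G => ?_
  let X' : Fin 3 → specializable L a := fun i => ⟨X i, ha i⟩
  have h1 : aeval X G = ((aeval X' G : specializable L a) : RatFunc L) :=
    (MvPolynomial.comp_aeval_apply X' (specializable L a).val G).symm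
  rw [h1, ← specialize_apply, MvPolynomial.comp_aeval_apply]
  rfl

/-- An equation over `L` that holds at infinitely many points of the curve `X` holds for `X`. -/
theorem aeval_eq_zero_of_frequently {X : Fin 3 → RatFunc L} {G : MvPolynomial (Fin 3) L}
    (h : ∃ᶠ a in cofinite, aeval (curvePoint X a) G = 0) : aeval X G = 0 :=
  eq_zero_of_frequently_eval <|
    (h.and_eventually (eventually_eval_aeval X)).mono fun a ha => by rw [ha.2, ha.1]

end CurvePoints

section Descent

variable {σ L K : Type*} [Field L] [Field K] [Algebra L K]

/-- The polynomial over `L` obtained by applying a linear form `f : K → L` to the coefficients. -/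
def coeffMap (f : K →ₗ[L] L) (G : MvPolynomial σ K) : MvPolynomial σ L :=
  ∑ m ∈ G.support, monomial m (f (coeff m G))

theorem coeff_coeffMap (f : K →ₗ[L] L) (G : MvPolynomial σ K) (m : σ →₀ ℕ) :
    coeff m (coeffMap f G) = f (coeff m G) := by
  classical
  rw [coeffMap, coeff_sum]
  simp only [coeff_monomial, Finset.sum_ite_eq']
  split_ifs with h
  · rfl
  · rw [notMem_support_iff.mp h, map_zero]

/-- At points with coordinates in `L`, evaluation commutes with linear forms. -/
theorem aeval_coeffMap (f : K →ₗ[L] L) (G : MvPolynomial σ K) (q : σ → L) :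
    aeval q (coeffMap f G) = f (aeval (fun i => algebraMap L K (q i)) G) := by
  have : aeval (fun i => algebraMap L K (q i)) G =
      ∑ m ∈ G.support, (m.prod fun i e => q i ^ e) • coeff m G := by
    conv_lhs => rw [G.as_sum, map_sum]
    refine Finset.sum_congr rfl fun m _ => ?_
    rw [aeval_monomial, Algebra.smul_def, Finsupp.prod, Finsupp.prod, map_prod, mul_comm]
    simp
  rw [this, map_sum, coeffMap, map_sum]
  refine Finset.sum_congr rfl fun m _ => ?_
  rw [aeval_monomial, map_smul, smul_eq_mul, mul_comm]
  rfl

/-- A polynomial over `K` belongs to the extension of an ideal over `L` as soon as its images under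
all linear forms `K → L` belong to that ideal. -/
theorem mem_map_of_coeffMap_mem {I : Ideal (MvPolynomial σ L)} {G : MvPolynomial σ K}
    (h : ∀ f : K →ₗ[L] L, coeffMap f G ∈ I) : G ∈ I.map (MvPolynomial.map (algebraMap L K)) := by
  classical
  let b := Module.Basis.ofVectorSpace L K
  let T := G.support.biUnion fun m => (b.repr (coeff m G)).support
  have hG : G = ∑ i ∈ T, C (b i) * MvPolynomial.map (algebraMap L K) (coeffMap (b.coord i) G) := by
    ext m
    simp only [coeff_sum, coeff_C_mul, coeff_map, coeff_coeffMap, Module.Basis.coord_apply]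
    by_cases hm : m ∈ G.support
    · conv_lhs => rw [← b.linearCombination_repr (coeff m G), Finsupp.linearCombination_apply]
      rw [Finsupp.sum_of_support_subset (s := T) _ (fun i hi => Finset.mem_biUnion.mpr ⟨m, hm, hi⟩)
        (fun i c => c • b i) (fun i _ => zero_smul _ _)]
      refine Finset.sum_congr rfl fun i _ => ?_
      rw [Algebra.smul_def, mul_comm]
    · rw [notMem_support_iff.mp hm]
      simp
  rw [hG]
  exact sum_mem fun i _ => Ideal.mul_mem_left _ _ (Ideal.mem_map_of_mem _ (h _))

end Descent

section CurveIdeal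

open Filter

variable {L : Type*} [Field L] {K : Type*} [Field K] [Algebra L K] {X : Fin 3 → RatFunc L}

variable (K) in
/-- The curve in `K³` parametrized by `X`: the Zariski closure of the image. -/
def rationalCurve (X : Fin 3 → RatFunc L) : Set (Fin 3 → K) :=
  zeroLocus K (RingHom.ker (aeval X : MvPolynomial (Fin 3) L →ₐ[L] RatFunc L))

variable (K) in
theorem eventually_mem_rationalCurve (X : Fin 3 → RatFunc L) :
    ∀ᶠ a in cofinite, basePoint K (curvePoint X a) ∈ rationalCurve K X := by
  refine (eventually_eval_aeval X).mono fun a ha G hG => ?_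
  have h := ha G
  rw [(RingHom.mem_ker).mp hG, RatFunc.eval_zero] at h
  have := MvPolynomial.comp_aeval_apply (curvePoint X a) (Algebra.ofId L K) G
  rw [← h, map_zero] at this
  exact this.symm

/-- A polynomial over `K` that vanishes at infinitely many points `X(a)`, `a ∈ L`, is a combination
of equations over `L` of the curve. -/
theorem mem_map_ker_of_frequently {G : MvPolynomial (Fin 3) K}
    (h : ∃ᶠ a in cofinite, aeval (basePoint K (curvePoint X a)) G = 0) :
    G ∈ (RingHom.ker (aeval X : MvPolynomial (Fin 3) L →ₐ[L] RatFunc L)).map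
      (MvPolynomial.map (algebraMap L K)) :=
  mem_map_of_coeffMap_mem fun f => RingHom.mem_ker.mpr <| aeval_eq_zero_of_frequently <|
    h.mono fun a ha => by rw [aeval_coeffMap]; exact (congrArg f ha).trans (map_zero f)

/-- The equations over `K` of a rational curve are generated by its equations over `L`. -/
theorem vanishingIdeal_rationalCurve [CharZero L] (X : Fin 3 → RatFunc L) :
    vanishingIdeal K (rationalCurve K X) =
      (RingHom.ker (aeval X : MvPolynomial (Fin 3) L →ₐ[L] RatFunc L)).map
        (MvPolynomial.map (algebraMap L K)) := by
  apply le_antisymm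
  · intro G hG
    exact mem_map_ker_of_frequently
      ((eventually_mem_rationalCurve K X).mono fun a ha => hG _ ha).frequently
  · rw [Ideal.map_le_iff_le_comap]
    intro G hG p hp
    rw [aeval_map_algebraMap]
    exact hp G hG

/-- A polynomial vanishes on the curve `X` if it vanishes at infinitely many points `X(a)` with
`a ∈ L`. -/
theorem mem_vanishingIdeal_of_frequently [CharZero L] {G : MvPolynomial (Fin 3) K}
    (h : ∃ᶠ a in cofinite, aeval (basePoint K (curvePoint X a)) G = 0) :
    G ∈ vanishingIdeal K (rationalCurve K X) := by
  rw [vanishingIdeal_rationalCurve]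
  exact mem_map_ker_of_frequently h

/-- If a product vanishes on the curve, one of the factors vanishes at infinitely many points
`X(a)`, hence on the curve. -/
theorem isPrime_vanishingIdeal [CharZero L] (X : Fin 3 → RatFunc L) :
    (vanishingIdeal K (rationalCurve K X)).IsPrime := by
  have hev := eventually_mem_rationalCurve K X
  refine ⟨?_, fun {G H} hGH => ?_⟩
  · rw [Ideal.ne_top_iff_one]
    intro h1
    obtain ⟨a, ha⟩ := hev.exists
    exact one_ne_zero ((map_one (aeval (R := K) _)).symm.trans (h1 _ ha))
  · have h : ∃ᶠ a in cofinite, aeval (basePoint K (curvePoint X a)) G = 0 ∨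
        aeval (basePoint K (curvePoint X a)) H = 0 :=
      (hev.mono fun a ha => mul_eq_zero.mp
        ((map_mul (aeval (R := K) _) _ _).symm.trans (hGH _ ha))).frequently
    exact (frequently_or_distrib.mp h).imp mem_vanishingIdeal_of_frequently
      mem_vanishingIdeal_of_frequently

theorem zariskiClosure_zeroLocus (I : Ideal (MvPolynomial (Fin 3) L)) :
    zariskiClosure (zeroLocus K I) = zeroLocus K I := by
  apply le_antisymm
  · intro p hp G hG
    rw [← aeval_map_algebraMap K]
    refine hp _ fun q hq => ?_
    rw [aeval_map_algebraMap]
    exact hq G hG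
  · exact zeroLocus_vanishingIdeal_le _

end CurveIdeal
end DevelopableSurface
end

noncomputable section
namespace DevelopableSurface
open MvPolynomial

/-! ### Rational space curves and their tangent spaces -/

section Relations

variable {L : Type*} [Field L]

theorem exists_relation (x : Fin 2 → RatFunc L) :
    ∃ g : MvPolynomial (Fin 2) L, g ≠ 0 ∧ aeval x g = 0 := by
  by_contra! h
  have hx : AlgebraicIndependent L x := by
    rw [algebraicIndependent_iff]
    intro g hg
    by_contra hg0
    exact h g hg0 hg
  have := hx.lift_cardinalMk_le_trdeg
  rw [trdeg_ratFunc] at this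
  simp at this

/-- Two coordinates of a rational curve satisfy an equation whose derivative with respect to the
second one is nonzero along the curve, if the first one is not constant: take an equation of least
degree. -/
theorem exists_relation_pderiv_ne_zero [CharZero L] {X : Fin 3 → RatFunc L} {i j : Fin 3}
    (hij : i ≠ j) (hi : dX L (X i) ≠ 0) :
    ∃ G : MvPolynomial (Fin 3) L, aeval X G = 0 ∧ aeval X (pderiv j G) ≠ 0 ∧
      ∀ l, l ≠ i → l ≠ j → pderiv l G = 0 := by
  classical
  have hex : ∃ d, ∃ g : MvPolynomial (Fin 2) L, g ≠ 0 ∧ aeval (X ∘ ![i, j]) g = 0 ∧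
      g.totalDegree = d := by
    obtain ⟨g, hg, hg0⟩ := exists_relation (X ∘ ![i, j])
    exact ⟨_, g, hg, hg0, rfl⟩
  obtain ⟨g, hg, hg0, hd⟩ := Nat.find_spec hex
  have hmin : ∀ k, aeval (X ∘ ![i, j]) (pderiv k g) = 0 → pderiv k g = 0 := by
    intro k hk
    by_contra h0
    refine Nat.find_min hex (m := (pderiv k g).totalDegree) ?_ ⟨_, h0, hk, rfl⟩
    rw [← hd]
    exact totalDegree_pderiv_lt h0
  have hinj : Function.Injective ![i, j] := by
    intro a b hab
    fin_cases a <;> fin_cases b <;> simp_all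
  have hpd : ∀ k, aeval X (pderiv (![i, j] k) (rename ![i, j] g)) =
      aeval (X ∘ ![i, j]) (pderiv k g) := by
    intro k
    rw [pderiv_rename hinj, aeval_rename]
  have hvars : ∀ l, l ≠ i → l ≠ j → pderiv l (rename ![i, j] g) = 0 := by
    intro l hli hlj
    refine pderiv_eq_zero_of_notMem_vars fun hl => ?_
    have := vars_rename _ _ hl
    rw [Finset.mem_image] at this
    obtain ⟨a, -, ha⟩ := this
    fin_cases a
    · exact hli ha.symm
    · exact hlj ha.symm
  have hG : aeval X (rename ![i, j] g) = 0 := by rw [aeval_rename, hg0]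
  refine ⟨rename ![i, j] g, hG, fun h1 => ?_, hvars⟩
  have h1' : pderiv 1 g = 0 := hmin 1 (by rw [← hpd]; exact h1)
  have h0' : pderiv 0 g = 0 := by
    apply hmin 0
    rw [← hpd]
    have h2 := derivation_aeval (dX L) X (rename ![i, j] g)
    rw [hG, map_zero, dotProduct, Finset.sum_eq_single i] at h2
    · exact (mul_eq_zero.mp h2.symm).resolve_right hi
    · intro l _ hli
      by_cases hlj : l = j
      · rw [polyGradient, hlj, h1, zero_mul]
      · rw [polyGradient, hvars l hli hlj, map_zero, zero_mul]
    · simp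
  obtain ⟨k, hk⟩ := exists_degreeOf_pos hg hg0
  fin_cases k
  · exact pderiv_ne_zero hk h0'
  · exact pderiv_ne_zero hk h1'

end Relations

section SpaceCurve

open Filter

variable {L : Type*} [Field L] [CharZero L] {K : Type*} [Field K] [Algebra L K]
  {X : Fin 3 → RatFunc L}

theorem tendsto_eval_cofinite {f : RatFunc L} (hf : dX L f ≠ 0) :
    Tendsto (fun a => RatFunc.eval (RingHom.id L) a f) cofinite cofinite := by
  refine Tendsto.cofinite_of_finite_preimage_singleton fun c => ?_
  by_contra hc
  have h : f - RatFunc.C c = 0 := by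
    apply eq_zero_of_frequently_eval
    have h1 : ∃ᶠ a in cofinite, RatFunc.eval (RingHom.id L) a f = c := by
      rw [frequently_cofinite_iff_infinite]; exact hc
    refine (h1.and_eventually (eventually_mem_specializable f)).mono fun a ha => ?_
    rw [sub_eq_add_neg, ← map_neg, RatFunc.eval_add _ _ ha.2 (by
      rw [RatFunc.denom_C]; simp), ha.1, RatFunc.eval_C, RingHom.id_apply, add_neg_cancel]
  rw [sub_eq_zero] at h
  exact hf (by rw [h, dX_C])

/-- A nonconstant rational curve is an irreducible algebraic curve.  Two of its coordinates satisfy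
an equation, since `L(t)` has transcendence degree one, and a nonconstant coordinate takes
infinitely many values. -/
theorem isAlgebraicCurve_rationalCurve (hX : curveDeriv X ≠ 0) :
    IsAlgebraicCurve (rationalCurve K X) := by
  have hprime := isPrime_vanishingIdeal (K := K) X
  refine ⟨(zariskiClosure_zeroLocus _).symm, hprime, ?_⟩
  set I := vanishingIdeal K (rationalCurve K X) with hI
  set A := MvPolynomial (Fin 3) K ⧸ I with hA
  set x : Fin 3 → A := fun i => Ideal.Quotient.mk I (MvPolynomial.X i) with hx
  have hmk : ∀ G, aeval x G = Ideal.Quotient.mk I G := by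
    intro G
    have : (aeval x : MvPolynomial (Fin 3) K →ₐ[K] A) = Ideal.Quotient.mkₐ K I := by
      ext i; simp only [hx, aeval_X]; rfl
    rw [this]; rfl
  obtain ⟨i, hi⟩ := Function.ne_iff.mp hX
  have htr : Transcendental K (x i) := by
    rintro ⟨p, hp, hp0⟩
    have h1 : Polynomial.aeval (MvPolynomial.X i : MvPolynomial (Fin 3) K) p ∈ I := by
      rw [← Ideal.Quotient.eq_zero_iff_mem, ← hp0]
      exact (Polynomial.aeval_algHom_apply (Ideal.Quotient.mkₐ K I) _ p).symm
    have h2 : ∀ᶠ c in cofinite, ¬ p.IsRoot c := by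
      rw [eventually_cofinite]; simpa using Polynomial.finite_setOfPred_isRoot hp
    have h3 := ((algebraMap L K).injective.tendsto_cofinite.comp
      (tendsto_eval_cofinite hi)).eventually h2
    obtain ⟨a, ha, hm⟩ := (h3.and (eventually_mem_rationalCurve K X)).exists
    apply ha
    have h4 := h1 _ hm
    rw [← Polynomial.aeval_algHom_apply, aeval_X] at h4
    exact h4
  have halg : Algebra.IsAlgebraic (Algebra.adjoin K (Set.range x)) A := by
    have : Algebra.adjoin K (Set.range x) = ⊤ := by
      rw [← top_le_iff]
      intro y _
      obtain ⟨G, rfl⟩ := Ideal.Quotient.mk_surjective y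
      rw [← hmk, Algebra.adjoin_range_eq_range_aeval]
      exact ⟨G, rfl⟩
    refine ⟨fun y => isAlgebraic_algebraMap (⟨y, ?_⟩ : Algebra.adjoin K (Set.range x))⟩
    rw [this]; trivial
  obtain ⟨t, hts, ht⟩ := exists_isTranscendenceBasis_subset (R := K) (Set.range x)
  rw [← ht.cardinalMk_eq_trdeg]
  apply le_antisymm
  · rw [Cardinal.le_one_iff_subsingleton]
    refine ⟨fun u v => ?_⟩
    by_contra huv
    obtain ⟨a, ha⟩ := hts u.2
    obtain ⟨b, hb⟩ := hts v.2
    obtain ⟨g, hg, hg0⟩ := exists_relation (X ∘ ![a, b])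
    have hinj : Function.Injective ![u, v] := by
      intro a b hab
      fin_cases a <;> fin_cases b <;> simp_all
    have hind := ht.1.comp ![u, v] hinj
    rw [algebraicIndependent_iff] at hind
    have h5 : aeval ((fun y : t => (y : A)) ∘ ![u, v])
        (MvPolynomial.map (algebraMap L K) g) = 0 := by
      have h6 : ((fun y : t => (y : A)) ∘ ![u, v]) = x ∘ ![a, b] := by
        funext k; fin_cases k
        · exact ha.symm
        · exact hb.symm
      rw [h6, ← aeval_rename, hmk, Ideal.Quotient.eq_zero_iff_mem, ← map_rename]
      intro p hp
      rw [aeval_map_algebraMap]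
      exact hp _ (RingHom.mem_ker.mpr (by rw [aeval_rename, hg0]))
    have h7 := hind _ h5
    exact hg (map_injective _ (algebraMap L K).injective (by rw [h7, map_zero]))
  · rw [ht.cardinalMk_eq_trdeg]
    have : AlgebraicIndependent K (fun _ : Unit => x i) :=
      algebraicIndependent_unique_type_iff.mpr htr
    simpa using this.lift_cardinalMk_le_trdeg

/-- A rational curve whose osculating plane has a nonconstant direction `N` is not planar.  A linear
form `K → L` turns the equation of a plane over `K` into one over `L`, whose normal vector is then
orthogonal to `X'` and `X''`, hence proportional to `N`. -/
theorem not_isPlanar_rationalCurve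
    (hX : crossProduct (curveDeriv X) (curveDeriv (curveDeriv X)) ≠ 0)
    {N : Fin 3 → RatFunc L} {j : Fin 3} (hN : N j = 1) (hN' : curveDeriv N ≠ 0)
    (h1 : N ⬝ᵥ curveDeriv X = 0) (h2 : N ⬝ᵥ curveDeriv (curveDeriv X) = 0) :
    ¬ IsPlanar (rationalCurve K X) := by
  rintro ⟨a, b, ha, hC⟩
  obtain ⟨i, hi⟩ := Function.ne_iff.mp ha
  obtain ⟨f, hf⟩ : ∃ f : Module.Dual L K, f (a i) ≠ 0 := by
    by_contra! h
    exact hi ((Module.forall_dual_apply_eq_zero_iff L _).mp h)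
  set w : Fin 3 → RatFunc L := fun i => RatFunc.C (f (a i)) with hw
  have hw' : curveDeriv w = 0 := by ext i; simp [curveDeriv, hw]
  have hw0 : w ≠ 0 := fun h => hf (RatFunc.C_injective (by simpa [hw] using congrFun h i))
  have h3 : w ⬝ᵥ X = RatFunc.C (f b) := by
    have := aeval_eq_zero_of_frequently (X := X)
      (G := ∑ i, C (f (a i)) * MvPolynomial.X i - C (f b))
      ((eventually_mem_rationalCurve K X).mono fun t ht => by
        have h4 : (a ⬝ᵥ basePoint K (curvePoint X t)) = b := hC ht
        rw [← h4, dotProduct, map_sum, map_sub, map_sum, aeval_C, Algebra.algebraMap_self_apply,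
          sub_eq_zero]
        refine Finset.sum_congr rfl fun i _ => ?_
        rw [basePoint, mul_comm (a i), ← Algebra.smul_def, map_smul, smul_eq_mul, mul_comm]
        simp).frequently
    rw [map_sub, map_sum, sub_eq_zero] at this
    simpa [dotProduct, hw, RatFunc.algebraMap_eq_C] using this
  have h4 : w ⬝ᵥ curveDeriv X = 0 := by
    have := congrArg (dX L) h3
    rwa [dX_dotProduct, hw', zero_dotProduct, zero_add, dX_C] at this
  have h5 : w ⬝ᵥ curveDeriv (curveDeriv X) = 0 := by
    have := congrArg (dX L) h4
    rwa [dX_dotProduct, hw', zero_dotProduct, zero_add, map_zero] at this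
  obtain ⟨c, hc⟩ := eq_smul_of_orthogonal hX h1 h2 h4 h5 hw0
  have hcj : c * RatFunc.C (f (a j)) = 1 := by
    have := congrFun hc j; rw [hN] at this; exact this.symm
  apply hN'
  have hc' : c = RatFunc.C (f (a j))⁻¹ := by
    rw [map_inv₀]; exact eq_inv_of_mul_eq_one_left hcj
  ext i
  rw [hc, hc', curveDeriv, Pi.smul_apply, smul_eq_mul, hw, ← map_mul, dX_C]
  rfl

/-- Tangent vectors of a rational curve are determined by the equations over `L`. -/
theorem mem_tangentSpace_iff {p : Fin 3 → K} (hp : p ∈ rationalCurve K X) (v : Fin 3 → K) :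
    v ∈ tangentSpace (rationalCurve K X) p ↔
      ∀ G : MvPolynomial (Fin 3) L, aeval X G = 0 → polyGradient G p ⬝ᵥ v = 0 := by
  have hmap : ∀ G : MvPolynomial (Fin 3) L,
      polyGradient (MvPolynomial.map (algebraMap L K) G) p = polyGradient G p := by
    intro G
    ext i
    rw [polyGradient, polyGradient, pderiv_map, aeval_map_algebraMap]
  constructor
  · intro hv G hG
    rw [← hmap]
    refine hv _ ?_
    rw [vanishingIdeal_rationalCurve]
    exact Ideal.mem_map_of_mem _ (RingHom.mem_ker.mpr hG)
  · intro h G hG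
    have hG' := hG
    rw [vanishingIdeal_rationalCurve] at hG'
    refine Submodule.span_induction (p := fun H _ => aeval p H = 0 ∧ polyGradient H p ⬝ᵥ v = 0)
      ?_ ?_ ?_ ?_ hG' |>.2
    · rintro _ ⟨H, hH, rfl⟩
      rw [hmap, aeval_map_algebraMap]
      exact ⟨hp H hH, h H hH⟩
    · simp [polyGradient, dotProduct]
    · rintro H₁ H₂ - - ⟨h1, h2⟩ ⟨h3, h4⟩
      have : polyGradient (H₁ + H₂) p = polyGradient H₁ p + polyGradient H₂ p := by
        ext i; simp [polyGradient]
      rw [map_add, h1, h3, this, add_dotProduct, h2, h4, add_zero]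
      exact ⟨rfl, rfl⟩
    · rintro a H - ⟨h1, h2⟩
      have : polyGradient (a • H) p = aeval p a • polyGradient H p := by
        ext i
        simp only [polyGradient, smul_eq_mul, Derivation.leibniz, map_add, map_mul, h1, zero_mul,
          add_zero, Pi.smul_apply]
      rw [smul_eq_mul, map_mul, h1, mul_zero, ← smul_eq_mul, this, smul_dotProduct, h2, smul_zero]
      exact ⟨rfl, rfl⟩

/-- At almost every point `X(a)`, the tangent space is the line spanned by `X'(a)`: equations
between a nonconstant coordinate and each of the other two determine a tangent vector from its
component in the direction of that coordinate. -/
theorem eventually_tangentSpace (hX : curveDeriv X ≠ 0) :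
    ∀ᶠ a in cofinite,
      Module.finrank K (tangentSpace (rationalCurve K X) (basePoint K (curvePoint X a))) = 1 ∧
      basePoint K (curvePoint (curveDeriv X) a) ∈
        tangentSpace (rationalCurve K X) (basePoint K (curvePoint X a)) := by
  obtain ⟨i, hi⟩ := Function.ne_iff.mp hX
  have hG : ∀ j, ∃ G : MvPolynomial (Fin 3) L, j ≠ i → aeval X G = 0 ∧ aeval X (pderiv j G) ≠ 0 ∧
      ∀ l, l ≠ i → l ≠ j → pderiv l G = 0 := fun j => by
    by_cases hj : j = i
    · exact ⟨0, fun h => absurd hj h⟩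
    · obtain ⟨G, h⟩ := exists_relation_pderiv_ne_zero (Ne.symm hj) hi
      exact ⟨G, fun _ => h⟩
  choose G hG using hG
  have hne : ∀ {f : RatFunc L}, f ≠ 0 →
      ∀ᶠ a in cofinite, RatFunc.eval (RingHom.id L) a f ≠ 0 := by
    intro f hf
    by_contra h
    exact hf (eq_zero_of_frequently_eval (by simpa [Filter.Frequently] using h))
  have h1 : ∀ᶠ a in cofinite, ∀ j, j ≠ i →
      RatFunc.eval (RingHom.id L) a (aeval X (pderiv j (G j))) ≠ 0 :=
    eventually_all.mpr fun j => by
      by_cases hj : j = i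
      · exact Eventually.of_forall fun a h => absurd hj h
      · exact (hne (hG j hj).2.1).mono fun a h _ => h
  have h2 : ∀ᶠ a in cofinite, ∀ j, X j ∈ specializable L a ∧ curveDeriv X j ∈ specializable L a :=
    eventually_all.mpr fun j =>
      (eventually_mem_specializable _).and (eventually_mem_specializable _)
  filter_upwards [h1, h2, hne hi, eventually_eval_aeval X, eventually_mem_rationalCurve K X]
    with a ha1 ha2 ha3 ha4 ha5
  set p := basePoint K (curvePoint X a) with hp
  set v := basePoint K (curvePoint (curveDeriv X) a) with hv
  have hcast : ∀ H : MvPolynomial (Fin 3) L, aeval p H =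
      algebraMap L K (RatFunc.eval (RingHom.id L) a (aeval X H)) := by
    intro H
    rw [ha4]
    exact (MvPolynomial.comp_aeval_apply (curvePoint X a) (Algebra.ofId L K) H).symm
  have hvT : v ∈ tangentSpace (rationalCurve K X) p := by
    rw [mem_tangentSpace_iff ha5]
    intro H hH
    have h3 := derivation_aeval (dX L) X H
    rw [hH, map_zero] at h3
    let X' : Fin 3 → specializable L a := fun i => ⟨X i, (ha2 i).1⟩
    let V' : Fin 3 → specializable L a := fun i => ⟨curveDeriv X i, (ha2 i).2⟩
    have h4 : polyGradient H X ⬝ᵥ curveDeriv X =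
        ((∑ i, aeval X' (pderiv i H) * V' i : specializable L a) : RatFunc L) := by
      rw [dotProduct]
      push_cast
      refine Finset.sum_congr rfl fun i _ => ?_
      congr 1
      exact (MvPolynomial.comp_aeval_apply X' (specializable L a).val _).symm
    have h5 : (∑ i, aeval X' (pderiv i H) * V' i : specializable L a) = 0 := by
      apply Subtype.ext
      rw [← h4]
      exact h3.symm
    have h6 := congrArg (fun y => algebraMap L K (specialize L a y)) h5
    simp only [map_sum, map_mul, map_zero] at h6
    rw [dotProduct, ← h6]
    refine Finset.sum_congr rfl fun i _ => ?_
    congr 1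
    rw [polyGradient, hcast, specialize_apply]
    congr 2
    exact (MvPolynomial.comp_aeval_apply X' (specializable L a).val _).symm
  have hvi : v i ≠ 0 := by
    rw [hv, basePoint, ne_eq, map_eq_zero]; exact ha3
  refine ⟨?_, hvT⟩
  rw [finrank_eq_one_iff_of_nonzero' (⟨v, hvT⟩ : tangentSpace (rationalCurve K X) p)
    (fun h => hvi (congrFun (congrArg Subtype.val h) i))]
  rintro ⟨w, hw⟩
  refine ⟨w i / v i, Subtype.ext ?_⟩
  change (w i / v i) • v = w
  have h7 : ∀ u ∈ tangentSpace (rationalCurve K X) p, u i = 0 → u = 0 := by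
    intro u hu hui
    ext j
    by_cases hj : j = i
    · rw [hj, hui]; rfl
    · obtain ⟨g1, -, g3⟩ := hG j hj
      have h8 := (mem_tangentSpace_iff ha5 u).mp hu _ g1
      rw [dotProduct, Finset.sum_eq_single j] at h8
      · refine (mul_eq_zero.mp h8).resolve_left ?_
        rw [polyGradient, hcast, map_eq_zero]
        exact ha1 j hj
      · intro l _ hlj
        by_cases hli : l = i
        · rw [hli, hui, mul_zero]
        · rw [polyGradient, g3 l hli hlj, map_zero, zero_mul]
      · simp
  rw [← sub_eq_zero]
  refine h7 _ (Submodule.sub_mem _ (Submodule.smul_mem _ _ hvT) hw) ?_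
  simp [div_mul_cancel₀ _ hvi]

end SpaceCurve
end DevelopableSurface
end

noncomputable section
namespace DevelopableSurface
open MvPolynomial

/-! ### Tangent surfaces -/

section Singularities

variable {L : Type*} [Field L] {K : Type*} [Field K] [Algebra L K]
  {F : MvPolynomial (Fin 3) L} {X : Fin 3 → RatFunc L}

theorem aeval_cross_pderiv {B : Type*} [Field B] [Algebra L B] (G H : MvPolynomial (Fin 3) L)
    (x : Fin 3 → B) (i : Fin 3) :
    aeval x (crossProduct (fun i => pderiv i G) (fun i => pderiv i H) i) =
      crossProduct (polyGradient G x) (polyGradient H x) i :=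
  map_cross (aeval x : MvPolynomial (Fin 3) L →ₐ[L] B).toRingHom (fun i => pderiv i G)
    (fun i => pderiv i H) i

/-- The surface `X + s X'` is singular along the curve `X`: its normal `∇F` is a multiple `μ N` of
the normal of the osculating plane, and `∂/∂t - ∂/∂s` changes the point only by `s X''`, so that the
derivative of `μ N`, and with it `μ N'`, is divisible by `s` up to a multiple of `N`. -/
theorem polyGradient_rationalCurve_eq_zero
    (hF : aeval (ruledParam X (curveDeriv X)) F = 0)
    (hX : crossProduct (curveDeriv X) (curveDeriv (curveDeriv X)) ≠ 0)
    {N : Fin 3 → RatFunc L} {j : Fin 3} (hN : N j = 1) (hN' : curveDeriv N ≠ 0)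
    (h1 : N ⬝ᵥ curveDeriv X = 0) (h2 : N ⬝ᵥ curveDeriv (curveDeriv X) = 0)
    {p : Fin 3 → K} (hp : p ∈ rationalCurve K X) : polyGradient F p = 0 := by
  set Y := curveDeriv X with hY
  set Z := curveDeriv Y with hZ
  set P := ruledParam X Y with hPdef
  set ι : RatFunc L →+* RatFunc₂ L := RatFunc.C with hι
  set n := polyGradient F P with hn
  have hPS : ∀ i, dS L (P i) = ι (Y i) := by
    intro i
    simp only [hPdef, ruledParam, map_add, dS_inT, Derivation.leibniz, dS_sVar,
      smul_eq_mul, mul_zero, zero_add, mul_one]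
    rfl
  have hPT : ∀ i, dT L (P i) = ι (Y i) + sVar * ι (Z i) := by
    intro i
    simp only [hPdef, ruledParam, map_add, dT_inT, Derivation.leibniz, dT_sVar,
      smul_eq_mul, mul_zero, add_zero]
    rfl
  have hnY : n ⬝ᵥ (ι ∘ Y) = 0 := by
    have := derivation_aeval (dS L) P F
    simp only [hF, map_zero, hPS] at this
    exact this.symm
  have hnZ : n ⬝ᵥ (ι ∘ Z) = 0 := by
    have := derivation_aeval (dT L) P F
    simp only [hF, map_zero, hPT] at this
    have h3 : (fun i => ι (Y i) + sVar * ι (Z i)) = ι ∘ Y + (sVar : RatFunc₂ L) • (ι ∘ Z) := by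
      ext i; simp
    rw [h3, dotProduct_add, dotProduct_smul, ← hn, hnY, zero_add, smul_eq_mul] at this
    exact (mul_eq_zero.mp this.symm).resolve_left RatFunc.X_ne_zero
  have hιdot : ∀ v w : Fin 3 → RatFunc L, (ι ∘ v) ⬝ᵥ (ι ∘ w) = ι (v ⬝ᵥ w) := by
    intro v w; simp [dotProduct]
  obtain ⟨μ, hμ⟩ := eq_smul_of_orthogonal (v := ι ∘ Y) (w := ι ∘ Z) (x := n) (y := ι ∘ N)
    (fun h0 => hX (by
      ext i
      have := map_cross ι Y Z i
      rw [h0, Pi.zero_apply, map_eq_zero] at this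
      exact this)) hnY hnZ (by rw [hιdot, h1, map_zero]) (by rw [hιdot, h2, map_zero])
    (fun h0 => by simpa [hN] using congrFun h0 j)
  have hμi : ∀ i, n i = μ * ι (N i) := fun i => congrFun hμ i
  have hμj : n j = μ := by rw [hμi, hN, map_one, mul_one]
  obtain ⟨i, hi⟩ := Function.ne_iff.mp hN'
  have hD : ∀ k, (dT L - dS L) (n k) =
      sVar * ∑ m, aeval P (pderiv m (pderiv k F)) * ι (Z m) := by
    intro k
    rw [hn, polyGradient, derivation_aeval, dotProduct, Finset.mul_sum]
    refine Finset.sum_congr rfl fun m _ => ?_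
    rw [Derivation.sub_apply, hPS, hPT, polyGradient]
    ring
  have hDN : (dT L - dS L) (ι (N i)) = ι (curveDeriv N i) := by
    rw [Derivation.sub_apply]
    change dT L (inT _) - dS L (inT _) = _
    rw [dT_inT, dS_inT, sub_zero]
    rfl
  have heq : n j * ι (curveDeriv N i) = sVar *
      ∑ m, (aeval P (pderiv m (pderiv i F)) - ι (N i) * aeval P (pderiv m (pderiv j F))) *
        ι (Z m) := by
    have h3 := hD i
    rw [hμi i, ← hμj, Derivation.leibniz, hD j, hDN, smul_eq_mul, smul_eq_mul] at h3
    simp only [sub_mul, Finset.sum_sub_distrib, mul_sub]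
    rw [← h3]
    simp only [mul_assoc, ← Finset.mul_sum]
    ring
  -- the identity holds between polynomials in `s`, and `s` may be set to zero
  have hinj := RatFunc.algebraMap_injective (RatFunc L)
  have hpoly : linePoly X Y (pderiv j F) * Polynomial.C (curveDeriv N i) = Polynomial.X *
      ∑ m, (linePoly X Y (pderiv m (pderiv i F)) -
        Polynomial.C (N i) * linePoly X Y (pderiv m (pderiv j F))) * Polynomial.C (Z m) := by
    apply hinj
    simp only [map_mul, map_sum, map_sub, algebraMap_linePoly, RatFunc.algebraMap_C,
      RatFunc.algebraMap_X]
    exact heq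
  have heval : ∀ H, (linePoly X Y H).eval 0 = aeval X H := by
    intro H
    simp only [eval_linePoly, zero_mul, add_zero]
  have hj0 : aeval X (pderiv j F) = 0 := by
    have := congrArg (Polynomial.eval 0) hpoly
    rw [Polynomial.eval_mul, Polynomial.eval_mul, Polynomial.eval_X, zero_mul, heval,
      Polynomial.eval_C] at this
    exact (mul_eq_zero.mp this).resolve_right hi
  ext l
  refine hp _ (RingHom.mem_ker.mpr ?_)
  have hl : linePoly X Y (pderiv l F) = linePoly X Y (pderiv j F) * Polynomial.C (N l) := by
    apply hinj
    rw [map_mul, algebraMap_linePoly, algebraMap_linePoly, RatFunc.algebraMap_C]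
    have := hμi l
    rw [← hμj] at this
    exact this
  have := congrArg (Polynomial.eval 0) hl
  rwa [Polynomial.eval_mul, heval, heval, hj0, zero_mul] at this

end Singularities

section TangentSurface

open Filter

variable {L : Type*} [Field L] [CharZero L] {K : Type*} [Field K] [Algebra L K]
  {F : MvPolynomial (Fin 3) L} {X : Fin 3 → RatFunc L}

/-- At a point `p` with a one-dimensional tangent space, two equations of the curve have
independent gradients. -/
theorem exists_cross_gradient_ne_zero {p : Fin 3 → K} (hp : p ∈ rationalCurve K X)
    (h1 : Module.finrank K (tangentSpace (rationalCurve K X) p) = 1) :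
    ∃ G H : MvPolynomial (Fin 3) L, aeval X G = 0 ∧ aeval X H = 0 ∧
      crossProduct (polyGradient G p) (polyGradient H p) ≠ 0 := by
  by_contra! hcon
  -- all gradients are multiples of one vector `n`, so the tangent space contains a plane
  obtain ⟨n, hn, hall⟩ : ∃ n : Fin 3 → K, n ≠ 0 ∧
      ∀ G : MvPolynomial (Fin 3) L, aeval X G = 0 → ∃ c : K, polyGradient G p = c • n := by
    by_cases h : ∃ G : MvPolynomial (Fin 3) L, aeval X G = 0 ∧ polyGradient G p ≠ 0
    · obtain ⟨G, hG, hG0⟩ := h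
      obtain ⟨i, hi⟩ := Function.ne_iff.mp hG0
      exact ⟨_, hG0, fun H hH => ⟨_, eq_smul_of_cross_eq_zero (hcon G H hG hH) hi⟩⟩
    · push Not at h
      refine ⟨Pi.single 0 1, fun h0 => ?_, fun G hG => ⟨0, by rw [h G hG, zero_smul]⟩⟩
      simpa using congrFun h0 0
  obtain ⟨v, w, c, hc, hv, hw, hvw⟩ := exists_cross_eq_smul_self hn
  have hmem : ∀ u, n ⬝ᵥ u = 0 → u ∈ tangentSpace (rationalCurve K X) p := by
    intro u hu
    rw [mem_tangentSpace_iff hp]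
    intro G hG
    obtain ⟨d, hd⟩ := hall G hG
    rw [hd, smul_dotProduct, hu, smul_zero]
  obtain ⟨u, -, hu⟩ := finrank_eq_one_iff'.mp h1
  obtain ⟨a, ha⟩ := hu ⟨v, hmem v hv⟩
  obtain ⟨b, hb⟩ := hu ⟨w, hmem w hw⟩
  have ha' : a • (u : Fin 3 → K) = v := congrArg Subtype.val ha
  have hb' : b • (u : Fin 3 → K) = w := congrArg Subtype.val hb
  rw [← ha', ← hb'] at hvw
  simp only [map_smul, LinearMap.smul_apply, cross_self, smul_zero] at hvw
  exact smul_ne_zero hc hn hvw.symm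

/-- The tangent lines of the curve `X` lie on the surface `X + s X'`.  The cross product of the
gradients of two equations of the curve is a polynomial vector field tangent to the curve; an
equation of the surface vanishes on its lines at the generic point, hence everywhere. -/
theorem tangentLines_subset (hX : curveDeriv X ≠ 0)
    (hF : aeval (ruledParam X (curveDeriv X)) F = 0) :
    tangentLines (rationalCurve K X) ⊆ surface K F := by
  rintro q ⟨p, hp, h1, hq⟩
  obtain ⟨G, H, hG, hH, hcross⟩ := exists_cross_gradient_ne_zero hp h1
  set W : Fin 3 → MvPolynomial (Fin 3) L :=
    crossProduct (fun i => pderiv i G) (fun i => pderiv i H) with hW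
  have hWp : ∀ i, aeval p (W i) = crossProduct (polyGradient G p) (polyGradient H p) i :=
    aeval_cross_pderiv G H p
  have hWX : ∀ i, aeval X (W i) = crossProduct (polyGradient G X) (polyGradient H X) i :=
    aeval_cross_pderiv G H X
  have hne : crossProduct (polyGradient G X) (polyGradient H X) ≠ 0 := by
    intro h0
    apply hcross
    ext i
    rw [← hWp]
    exact hp _ (RingHom.mem_ker.mpr (by rw [hWX, h0]; rfl))
  have hperp : ∀ E : MvPolynomial (Fin 3) L, aeval X E = 0 →
      curveDeriv X ⬝ᵥ polyGradient E X = 0 := by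
    intro E hE
    have := derivation_aeval (dX L) X E
    rw [hE, map_zero] at this
    rw [dotProduct_comm]
    exact this.symm
  -- the vector field is tangent to the curve at its generic point
  obtain ⟨l, hl⟩ := eq_smul_of_orthogonal hne
    (x := crossProduct (polyGradient G X) (polyGradient H X))
    (by rw [dotProduct_comm]; exact dot_self_cross _ _)
    (by rw [dotProduct_comm]; exact dot_cross_self _ _) (hperp G hG) (hperp H hH) hX
  have hq' := (mem_tangentSpace_iff hp (q - p)).mp hq
  obtain ⟨c, hc⟩ := eq_smul_of_orthogonal hcross
    (y := crossProduct (polyGradient G p) (polyGradient H p))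
    (by rw [dotProduct_comm]; exact hq' G hG) (by rw [dotProduct_comm]; exact hq' H hH)
    (by rw [dotProduct_comm]; exact dot_self_cross _ _)
    (by rw [dotProduct_comm]; exact dot_cross_self _ _) hcross
  have key := aeval_eval_eq_zero hp
    (fun i => Polynomial.C (MvPolynomial.X i) + Polynomial.X * Polynomial.C (W i)) F (by
      rw [← aeval_ruledParam_eq_zero hF (Polynomial.CAlgHom (R := L) (A := RatFunc L))
        (Polynomial.X * Polynomial.C l)]
      congr 2
      funext i
      have hi : aeval X (W i) = l * curveDeriv X i := (hWX i).trans (congrFun hl i)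
      simp only [Polynomial.coe_mapAlgHom, Polynomial.map_add, Polynomial.map_mul, Polynomial.map_C,
        Polynomial.map_X, RingHom.coe_coe, aeval_X, hi, Polynomial.CAlgHom_apply, map_mul,
        mul_assoc]) c
  change aeval q F = 0
  rw [← key]
  congr 2
  funext i
  have hi : q i - p i = c * aeval p (W i) := by
    rw [hWp]; exact congrFun hc i
  simp only [Polynomial.map_add, Polynomial.map_mul, Polynomial.map_C, Polynomial.map_X,
    Polynomial.eval_add, Polynomial.eval_mul, Polynomial.eval_C, Polynomial.eval_X,
    AlgHom.toRingHom_eq_coe, RingHom.coe_coe, aeval_X, ← hi]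
  ring

/-- An equation that holds on almost all tangent lines over the base field holds on the surface
`X + s X'`: restricted to the generic tangent line it has infinitely many zeros. -/
theorem mem_map_ker_of_tangentLines (hX : curveDeriv X ≠ 0) {G : MvPolynomial (Fin 3) K}
    (hG : G ∈ vanishingIdeal K (tangentLines (rationalCurve K X))) :
    G ∈ (RingHom.ker (aeval (ruledParam X (curveDeriv X)) :
      MvPolynomial (Fin 3) L →ₐ[L] RatFunc₂ L)).map (MvPolynomial.map (algebraMap L K)) := by
  refine mem_map_of_coeffMap_mem fun f => RingHom.mem_ker.mpr ?_
  have hroot : ∀ c : L, (linePoly X (curveDeriv X) (coeffMap f G)).IsRoot (RatFunc.C c) := by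
    intro c
    rw [Polynomial.IsRoot, eval_linePoly]
    apply aeval_eq_zero_of_frequently
    have hm : ∀ᶠ a in cofinite, ∀ i,
        X i ∈ specializable L a ∧ curveDeriv X i ∈ specializable L a :=
      eventually_all.mpr fun i =>
        (eventually_mem_specializable _).and (eventually_mem_specializable _)
    refine Eventually.frequently ?_
    filter_upwards [hm, eventually_tangentSpace (K := K) hX, eventually_mem_rationalCurve K X]
      with a ha1 ha2 ha3
    have hpt : curvePoint (fun i => X i + RatFunc.C c * curveDeriv X i) a =
        fun i => curvePoint X a i + c * curvePoint (curveDeriv X) a i := by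
      funext i
      have hcm : RatFunc.C c ∈ specializable L a := by
        rw [← RatFunc.algebraMap_eq_C]; exact Subalgebra.algebraMap_mem _ c
      rw [curvePoint, RatFunc.eval_add _ _ (ha1 i).1 (Subalgebra.mul_mem _ hcm (ha1 i).2),
        RatFunc.eval_mul _ _ hcm (ha1 i).2, RatFunc.eval_C]
      rfl
    rw [hpt, aeval_coeffMap]
    have hz := hG (fun i => algebraMap L K (curvePoint X a i + c * curvePoint (curveDeriv X) a i))
      ⟨basePoint K (curvePoint X a), ha3, ha2.1, by
        have := Submodule.smul_mem _ (algebraMap L K c) ha2.2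
        convert this using 1
        funext i
        simp [basePoint]⟩
    rw [hz, map_zero]
  have h0 : linePoly X (curveDeriv X) (coeffMap f G) = 0 := by
    apply Polynomial.eq_zero_of_infinite_isRoot
    exact (Set.infinite_range_of_injective (RatFunc.C_injective (K := L))).mono
      (by rintro _ ⟨c, rfl⟩; exact hroot c)
  rw [← algebraMap_linePoly, h0, map_zero]

/-- The surface of a tangent parametrization satisfies the tangential case. -/
theorem tangentialCase_of_form {Y : Fin 3 → RatFunc L} (hF : aeval (ruledParam X Y) F = 0)
    (hS : IsParametrization (L := L) (ruledParam X Y) (surface K F))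
    (htop : IntermediateField.adjoin L (Set.range (ruledParam X Y)) = ⊤)
    (h : IsTangentForm X Y) : TangentialCase K F := by
  obtain ⟨rfl, hXtop, hcross, N, j, hN, hN', h1, h2⟩ := h
  have hX : curveDeriv X ≠ 0 := by
    intro h0
    exact hcross (by rw [h0, map_zero, LinearMap.zero_apply])
  have h3 : N ⬝ᵥ curveDeriv (curveDeriv X) = 0 := by
    have := congrArg (dX L) h1
    rwa [dX_dotProduct, h2, zero_add, map_zero] at this
  have hplane := not_isPlanar_rationalCurve (K := K) hcross hN hN' h1 h3
  have hparam : tangentParam X = ruledParam X (curveDeriv X) := by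
    ext i; simp only [tangentParam, ruledParam, ratDeriv_eq_dX, curveDeriv]
  refine ⟨⟨rationalCurve K X, isAlgebraicCurve_rationalCurve hX, hplane, ?_⟩,
    rationalCurve K X, X, ?_, ?_, hplane, ⟨rfl, hXtop⟩, by rw [hparam]; exact ⟨hS, htop⟩⟩
  · apply le_antisymm
    · intro p hp G hG
      rw [hS] at hp
      refine Ideal.map_le_iff_le_comap (K := vanishingIdeal K {p}) |>.mpr ?_
        (mem_map_ker_of_tangentLines hX hG) p rfl
      rintro H hH _ rfl
      rw [aeval_map_algebraMap]
      exact hp H hH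
    · have hle := zeroLocus_anti_mono (K := K) (vanishingIdeal_anti_mono (k := K)
        (tangentLines_subset (K := K) hX hF))
      refine hle.trans ?_
      conv_rhs => rw [hS]
      rw [hS]
      exact (zariskiClosure_zeroLocus _).le
  · intro p hp
    refine hp F (RingHom.mem_ker.mpr ?_)
    have := aeval_ruledParam_eq_zero hF (AlgHom.id L (RatFunc L)) 0
    simpa using this
  · exact fun p hp => polyGradient_rationalCurve_eq_zero hF hcross hN hN' h1 h3 hp

end TangentSurface
end DevelopableSurface
end

noncomputable section
namespace DevelopableSurface
open MvPolynomial

/-! ### Ruledness -/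

section Ruled

variable {L : Type*} [Field L] {K : Type*} [Field K] [Algebra L K]
  {F : MvPolynomial (Fin 3) L}

theorem zariskiClosure_surface (F : MvPolynomial (Fin 3) L) :
    zariskiClosure (surface K F) = surface K F := by
  have : surface K F = zeroLocus K (Ideal.span {F}) := by
    rw [zeroLocus_span]; ext p; simp [surface]
  rw [this, zariskiClosure_zeroLocus]

theorem zariskiClosure_mono {S T : Set (Fin 3 → K)} (h : S ⊆ T) :
    zariskiClosure S ⊆ zariskiClosure T :=
  zeroLocus_anti_mono (vanishingIdeal_anti_mono h)

theorem isRuled_of_subset_zariskiClosure {T : Set (Fin 3 → K)}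
    (hT : ∀ q ∈ T, ∃ p v : Fin 3 → K, v ≠ 0 ∧ line p v ⊆ surface K F ∧ q ∈ line p v)
    (h : surface K F ⊆ zariskiClosure T) : IsRuled (surface K F) := by
  apply Set.Subset.antisymm
  · exact h.trans (zariskiClosure_mono hT)
  · conv_rhs => rw [← zariskiClosure_surface F]
    exact zariskiClosure_mono fun q ⟨p, v, _, hpv, hq⟩ => hpv hq

theorem CylindricalCase.isRuled (h : CylindricalCase K F) : IsRuled (surface K F) := by
  obtain ⟨b, ⟨hb, hcyl⟩, -⟩ := h
  exact isRuled_of_subset_zariskiClosure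
    (fun q hq => ⟨q, basePoint K b, hb, hcyl q hq, 0, by simp⟩) (zeroLocus_vanishingIdeal_le _)

/-- The apex lies on a line of the cone because the cone has a further point: by the
Nullstellensatz a parametrized plane section is not empty. -/
theorem ConicalCase.isRuled [IsAlgClosed K] (h : ConicalCase K F) : IsRuled (surface K F) := by
  obtain ⟨r, hcone, a, b, Q, -, hr, ⟨hQ, -⟩, -⟩ := h
  obtain ⟨q, hq, hqr⟩ : ∃ q ∈ surface K F, q ≠ basePoint K r := by
    obtain ⟨q, hq⟩ : (surface K F ∩ plane (basePoint K a) (algebraMap L K b)).Nonempty := by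
      rw [Set.nonempty_iff_ne_empty]
      intro h0
      rw [hQ] at h0
      have h1 := vanishingIdeal_zeroLocus_eq_radical (K := K)
        (RingHom.ker (aeval Q : MvPolynomial (Fin 3) L →ₐ[L] RatFunc L))
      rw [h0, vanishingIdeal_empty, (RingHom.ker_isPrime _).isRadical.radical] at h1
      exact (RingHom.ker_ne_top _) h1.symm
    exact ⟨q, hq.1, fun h0 => hr (h0 ▸ hq.2)⟩
  refine isRuled_of_subset_zariskiClosure (fun p hp => ?_) (zeroLocus_vanishingIdeal_le _)
  by_cases hpr : p = basePoint K r
  · exact ⟨_, _, sub_ne_zero.mpr hqr, hcone q hq, 0, by simp [hpr]⟩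
  · exact ⟨_, _, sub_ne_zero.mpr hpr, hcone p hp, 1, by simp⟩

theorem TangentialCase.isRuled (h : TangentialCase K F) : IsRuled (surface K F) := by
  obtain ⟨⟨C, -, -, hC⟩, -⟩ := h
  refine isRuled_of_subset_zariskiClosure (T := tangentLines C) ?_ hC.le
  rintro q ⟨p, hp, h1, hq⟩
  obtain ⟨v, hv, hall⟩ := finrank_eq_one_iff'.mp h1
  obtain ⟨c, hc⟩ := hall ⟨q - p, hq⟩
  have hc' : c • (v : Fin 3 → K) = q - p := congrArg Subtype.val hc
  refine ⟨p, v, fun h0 => hv (Subtype.ext h0), ?_, c, by rw [hc']; simp⟩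
  rw [hC]
  refine Set.Subset.trans ?_ (zeroLocus_vanishingIdeal_le _)
  rintro _ ⟨d, rfl⟩
  exact ⟨p, hp, h1, by
    rw [add_sub_cancel_left]; exact Submodule.smul_mem _ _ v.2⟩

end Ruled

/-! ### The classification of rational developable surfaces -/

section Main

variable {L : Type*} [Field L] {K : Type*} [Field K] [IsAlgClosed K] [Algebra L K]
  {F : MvPolynomial (Fin 3) L}

theorem aeval_eq_zero_of_forall_surface {E : Type*} [Field E] [Algebra L E] {P : Fin 3 → E}
    (hP : IsParametrization (L := L) P (surface K F)) {G : MvPolynomial (Fin 3) L}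
    (hG : ∀ p ∈ surface K F, aeval p G = 0) : aeval P G = 0 := by
  have h1 := vanishingIdeal_zeroLocus_eq_radical (K := K)
    (RingHom.ker (aeval P : MvPolynomial (Fin 3) L →ₐ[L] E))
  rw [(RingHom.ker_isPrime _).isRadical.radical, ← hP] at h1
  have h2 : G ∈ vanishingIdeal L (surface K F) := hG
  rwa [h1] at h2

theorem cases_of_isParametrization [CharZero L] (hF : Squarefree F) {P : Fin 3 → RatFunc₂ L}
    (hP : IsParametrization (L := L) P (surface K F))
    (hK : ∀ p ∈ surface K F, aeval p (borderedHessian F) = 0) :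
    ConicalCase K F ∨ CylindricalCase K F ∨ TangentialCase K F := by
  have hker := aeval_eq_zero_iff_dvd hF hP
  have hF0 := hF.ne_zero
  obtain ⟨φ, X, Y, τ, hu, hXY, hform⟩ := exists_form hF0 hker
    ((hker _).mp (aeval_eq_zero_of_forall_surface hP hK))
  obtain ⟨hiff, htop⟩ := ruledParam_proper (fun _ _ h => jacobian_injective hF0 hker h) φ hXY hu
  have hS : IsParametrization (L := L) (ruledParam X Y) (surface K F) := by
    have : RingHom.ker (aeval (ruledParam X Y) : MvPolynomial (Fin 3) L →ₐ[L] RatFunc₂ L) =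
        RingHom.ker (aeval P : MvPolynomial (Fin 3) L →ₐ[L] RatFunc₂ L) := Ideal.ext hiff
    rw [IsParametrization, this]
    exact hP
  have hFX : aeval (ruledParam X Y) F = 0 := (hiff F).mpr ((hker F).mpr dvd_rfl)
  rcases hform with h | h | h
  · exact Or.inr (Or.inl (cylindricalCase_of_form hFX hS htop h))
  · exact Or.inl (conicalCase_of_form hFX hS htop h)
  · exact Or.inr (Or.inr (tangentialCase_of_form hFX hS htop h))

end Main
end DevelopableSurface
end

open DevelopableSurface
theorem mainTheorem1 {L : Type*} [Field L] [CharZero L] {K : Type*} [Field K] [IsAlgClosed K]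
    [Algebra L K] (F : MvPolynomial (Fin 3) L) (hF : Squarefree F) :
    IsRationalDevelopable K F ↔
      (∀ p ∈ surface K F, MvPolynomial.aeval p (borderedHessian F) = 0) ∧
        (ConicalCase K F ∨ CylindricalCase K F ∨ TangentialCase K F) := by
  rw [← hasZeroGaussianCurvature_iff]
  constructor
  · rintro ⟨⟨-, hcurv⟩, P, hP⟩
    exact ⟨hcurv, cases_of_isParametrization hF hP ((hasZeroGaussianCurvature_iff F).mp hcurv)⟩
  · -- each of the three cases includes a parametrization of the surface
    rintro ⟨hcurv, h | h | h⟩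
    · exact ⟨⟨h.isRuled, hcurv⟩, let ⟨_, _, _, _, _, _, _, _, hP⟩ := h; ⟨_, hP.1⟩⟩
    · exact ⟨⟨h.isRuled, hcurv⟩, let ⟨_, _, _, _, _, _, _, hP⟩ := h; ⟨_, hP.1⟩⟩
    · exact ⟨⟨h.isRuled, hcurv⟩, let ⟨_, _, _, _, _, _, _, hP⟩ := h; ⟨_, hP.1⟩⟩
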